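/- **Conventions.** An infinite real matrix is *totally positive* (TP) if all its minors are nonnegative; a matrix over $\mathbb R[\mathbf x]$ is *$\mathbf x$-TP* if all its minors are polynomials in $\mathbf x$ with nonnegative coefficients. A series $\sum_{n\ge0}a_nt^n\in\mathbb R[[t]]$ is a *PF function* if its Toeplitz matrix $[a_{i-j}]_{i,j\ge0}$ (with $a_n=0$ for $n<0$) is TP. A real sequence $(a_n)_{n\ge0}$ is *Stieltjes moment* (SM) if $a_n=\int_0^\infty x^n\,d\mu(x)$ for all $n$, for some nonnegative measure $\mu$ on $[0,\infty)$; a sequence $(a_n)_{n\ge0}$ in $\mathbb R[\mathbf x]$ is *$\mathbf x$-SM* if its Hankel matrix $[a_{i+j}]_{i,j\ge0}$ is $\mathbf x$-TP. Put $\mathcal L[a_i]=a_{i-1}a_{i+1}-a_i^2$; the sequence is *$3$-$\mathbf x$-log-convex* (for real sequences: *$3$-log-convex*) if, for every $m\le 3$ and every index $i$ at which it is defined, $\mathcal L^m[a_i]$ has nonnegative coefficients (is nonnegative). Let $f(t)=\sum_{n\ge1}f_n\frac{t^n}{n!}\in\mathbb R[[t]]$ with $f_1\ne0$, and let $\bar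 f$ be its compositional inverse. For a power series $g$ with $g(0)\neq 0$, with coefficients in $\mathbb R$ or in a polynomial ring over $\mathbb R$, define $S_n(f,g;q)$ and $S_{n,k}(f,g)$ by $$g(t)\exp(qf(t))=\sum_{n\ge0}S_n(f,g;q)\frac{t^n}{n!},\qquad S_n(f,g;q)=\sum_{k=0}^nS_{n,k}(f,g)q^k,$$ with $S_{n,k}(f,g)=0$ for $k>n$, and let $S_n^*(f,g;q)=q^nS_n(f,g;1/q)$. Here $(1+f)^\gamma=\sum_{n\ge0}\binom{\gamma}{n}f^n$. **Theorem.** Suppose that $\dfrac{1}{(1+t)\bar f'(t)}$ is a PF function, and let $g(t)=(1+f(t))^{\gamma}\exp(\lambda f(t))$. In (i), (ii), (iv), $\gamma,\lambda,q$ are indeterminates; in (v), (vi), $\gamma,\lambda$ are real numbers. Then: - (i) both $(S_n(f,g;q))_{n\ge0}$ and $(S_n^*(f,g;q))_{n\ge0}$ are $(\gamma,\lambda,q)$-SM and $3$-$(\gamma,\lambda,q)$-log-convex; - (ii) $(S_n(f,(1+f)^\gamma;q))_{n\ge0}$ is $(\gamma,q)$-SM and $3$-$(\gamma,q)$-log-convex;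 - (iii) $(f_{n+1})_{n\ge0}$ is SM and $3$-log-convex; - (iv) the triangle $[S_{n,k}(f,g)]_{n,k\ge0}$ is $(\gamma,\lambda)$-TP; - (v) for $\gamma\ge0$ and $\lambda\ge0$, the triangle $\left[(-1)^{n-k}S_{n,k}\bigl(\bar f,1/g(\bar f)\bigr)\right]_{n,k\ge0}$ is TP; - (vi) for $\gamma\ge0$ and $\lambda\ge0$, the convolution $z_n=\sum_{k=0}^nS_{n,k}(f,g)\,x_k\,y_{n-k}$ preserves the SM property: if $(x_n)_{n\ge0}$ and $(y_n)_{n\ge0}$ are SM sequences of real numbers, then so is $(z_n)_{n\ge0}$. -/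

import Mathlib

/-! ### Total positivity, Stieltjes moments and iterated log-convexity -/

/-- The minor of an infinite matrix in the rows `r 0 < r 1 < ⋯` and columns `c 0 < c 1 < ⋯`. -/
def matMinor {R : Type*} [CommRing R] (M : Matrix ℕ ℕ R) {m : ℕ} (r c : Fin m ↪o ℕ) : R :=
  (M.submatrix r c).det

/-- A real infinite matrix is totally positive if all its minors are nonnegative. -/
def IsTP (M : Matrix ℕ ℕ ℝ) : Prop :=
  ∀ (m : ℕ) (r c : Fin m ↪o ℕ), 0 ≤ matMinor M r c

/-- A polynomial in the indeterminates `x_i`, `i : σ`, all of whose coefficients are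
nonnegative. -/
def CoeffNonneg {σ : Type*} (p : MvPolynomial σ ℝ) : Prop :=
  ∀ d : σ →₀ ℕ, 0 ≤ p.coeff d

/-- `𝐱`-total positivity of a matrix of polynomials in the indeterminates `𝐱 = (x_i)_{i : σ}`. -/
def IsCoeffTP {σ : Type*} (M : Matrix ℕ ℕ (MvPolynomial σ ℝ)) : Prop :=
  ∀ (m : ℕ) (r c : Fin m ↪o ℕ), CoeffNonneg (matMinor M r c)

/-- The infinite Hankel matrix `[a_{i+j}]`. -/
def hankelMatrix {R : Type*} (a : ℕ → R) : Matrix ℕ ℕ R :=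
  Matrix.of fun i j => a (i + j)

/-- The infinite Toeplitz matrix `[a_{i-j}]`, with `a_n = 0` for `n < 0`. -/
def toeplitzMatrix {R : Type*} [Zero R] (a : ℕ → R) : Matrix ℕ ℕ R :=
  Matrix.of fun i j => if j ≤ i then a (i - j) else 0

/-- A formal power series is a PF (Pólya frequency) function if the Toeplitz matrix of its
coefficient sequence is totally positive. -/
def IsPF (φ : PowerSeries ℝ) : Prop :=
  IsTP (toeplitzMatrix fun n => PowerSeries.coeff n φ)

/-- A real sequence is a Stieltjes moment sequence if it is the moment sequence of a nonnegative
measure on `[0, ∞)`. -/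
def IsStieltjesMoment (a : ℕ → ℝ) : Prop :=
  ∃ μ : MeasureTheory.Measure ℝ, μ (Set.Iio 0) = 0 ∧
    ∀ k : ℕ, MeasureTheory.Integrable (fun x : ℝ => x ^ k) μ ∧ a k = ∫ x, x ^ k ∂μ

/-- A polynomial sequence is `𝐱`-Stieltjes moment if its Hankel matrix is `𝐱`-totally
positive. -/
def IsCoeffSM {σ : Type*} (a : ℕ → MvPolynomial σ ℝ) : Prop :=
  IsCoeffTP (hankelMatrix a)

/-- The operator `ℒ[a_i] = a_{i-1} a_{i+1} - a_i ^ 2` (`i ≥ 1`), indexed from `0`: the value at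
`i` is `ℒ[a_{i+1}]`. Hence the value of its `m`-th iterate at `i` is `ℒ^m[a_{i+m}]`, which runs
through all the indices at which `ℒ^m` is defined. -/
def logConvexOp {R : Type*} [CommRing R] (a : ℕ → R) : ℕ → R :=
  fun i => a i * a (i + 2) - a (i + 1) ^ 2

/-- `k`-log-convexity of a real sequence. -/
def IsKLogConvex (k : ℕ) (a : ℕ → ℝ) : Prop :=
  ∀ m ≤ k, ∀ i : ℕ, 0 ≤ (logConvexOp^[m] a) i

/-- `k`-`𝐱`-log-convexity of a sequence of polynomials. -/
def IsKCoeffLogConvex {σ : Type*} (k : ℕ) (a : ℕ → MvPolynomial σ ℝ) : Prop :=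
  ∀ m ≤ k, ∀ i : ℕ, CoeffNonneg ((logConvexOp^[m] a) i)

/-! ### Sheffer polynomials and Sheffer triangles -/

section Sheffer

variable {R : Type*} [CommRing R]

/-- The formal power series `exp (c F(t))`, where `F(0) = 0`. -/
noncomputable def expSeries [Algebra ℚ R] (c : R) (F : PowerSeries R) : PowerSeries R :=
  (PowerSeries.exp R).subst (PowerSeries.C c * F)

/-- The formal power series `(1 + F(t)) ^ γ = ∑ₙ binom(γ, n) F(t) ^ n`, where `F(0) = 0`. -/
noncomputable def onePlusPow [BinomialRing R] (γ : R) (F : PowerSeries R) : PowerSeries R :=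
  (PowerSeries.binomialSeries R γ).subst F

/-- The formal power series `(1 + F(t)) ^ γ * exp (l F(t))`, where `F(0) = 0`. -/
noncomputable def shefferG [Algebra ℚ R] [BinomialRing R] (γ l : R) (F : PowerSeries R) :
    PowerSeries R :=
  onePlusPow γ F * expSeries l F

/-- The Sheffer polynomial `S_n(F, G; q)`, a polynomial in `q` over `R`, given by
`∑ₙ S_n(F, G; q) t ^ n / n! = G(t) exp (q F(t))`. -/
noncomputable def shefferPoly [Algebra ℚ R] (F G : PowerSeries R) (n : ℕ) : Polynomial R :=
  (n.factorial : Polynomial R) *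
    PowerSeries.coeff n
      (G.map Polynomial.C * expSeries (Polynomial.X : Polynomial R) (F.map Polynomial.C))

/-- The Sheffer triangle `S_{n,k}(F, G)`: the coefficient of `q ^ k` in `S_n(F, G; q)`. -/
noncomputable def shefferTriangle [Algebra ℚ R] (F G : PowerSeries R) : Matrix ℕ ℕ R :=
  Matrix.of fun n k => (shefferPoly F G n).coeff k

/-- The sequence `S_n(F, G; q)` at an element `q` of `R`. -/
noncomputable def shefferSeq [Algebra ℚ R] (F G : PowerSeries R) (q : R) : ℕ → R :=
  fun n => (shefferPoly F G n).eval q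

/-- The sequence of reciprocal polynomials `S*_n(F, G; q) = q ^ n S_n(F, G; 1/q)`, at an element
`q` of `R`. -/
noncomputable def shefferRecipSeq [Algebra ℚ R] (F G : PowerSeries R) (q : R) : ℕ → R :=
  fun n => ((shefferPoly F G n).reflect n).eval q

end Sheffer

/-- A real formal power series regarded as a series with coefficients in `ℝ[𝐱]`. -/
noncomputable def liftSeries (σ : Type*) (f : PowerSeries ℝ) : PowerSeries (MvPolynomial σ ℝ) :=
  f.map MvPolynomial.C

/-- The composition `G(F(t))` of real formal power series, where `F(0) = 0`. -/
noncomputable def composeSeries (G F : PowerSeries ℝ) : PowerSeries ℝ :=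
  G.subst F

/-- The triangular convolution `z_n = ∑_{k ≤ n} A_{n,k} x_k y_{n-k}`. -/
def triConvolution (A : Matrix ℕ ℕ ℝ) (x y : ℕ → ℝ) : ℕ → ℝ :=
  fun n => ∑ k ∈ Finset.range (n + 1), A n k * x k * y (n - k)

/-! ### Minors in a subsemiring -/

section MinorsIn

open Finset Matrix

variable {R : Type*} [CommRing R]

/-! Put φ = 1/((1+t) f̄'(t)). Differentiating f̄(f(t)) = t gives the differential equation f' =
(1+f) φ(f) (`derivative_eq_one_add_mul_subst`). Therefore the derivative of a column series g f^k /
k! is again a combination of column series, so the Sheffer triangle T satisfies T_{n+1,k} = ∑_j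
T_{n,j} P_{j,k} for an explicit production matrix P (`isOutputMatrix_of_derivative`). This P is the
Toeplitz matrix of φ, weighted by factorials, times a tridiagonal matrix, and the tridiagonal matrix
is a product of two staircase matrices whose minors are products of entries. By Cauchy–Binet all
minors of P are nonnegative (`minorsIn_shefferProduction`).

Row n of T is e₀ᵀ Pⁿ. Cauchy–Binet and induction on the rows carry nonnegativity from P to T
(`IsOutputMatrix.minorsIn`), and the splitting T_{i+j,0} = (e₀ᵀ Pⁱ)(Pʲ e₀) carries it to the Hankel
matrix of column 0 (`IsOutputMatrix.minorsIn_hankel`). To bring in q, the same argument is run on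
g(vt) exp(u f(vt)/v), whose column 0 is ∑_k S_{n,k} u^k v^{n-k}; the pairs (q, 1) and (1, q) give
S_n and S*_n. Everything is done for minors in a subsemiring, so that polynomials with nonnegative
coefficients and nonnegative reals are treated together.

The remaining assertions follow from these. Iterates of ℒ up to the third are polynomials with
nonnegative coefficients in Hankel minors of order at most 4. For (f_{n+1}), the first row and
column of P are deleted at γ = λ = 0. The inverse triangle is handled by Jacobi's formula for
complementary minors. Finally z_n is the integral of ∑_k S_{n,k} u^k v^{n-k} against the
representing measures of x and y, so its Hankel forms are positive semidefinite, and Stieltjes'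
theorem (`isStieltjesMoment_of_hankelPosSemidef`) yields a measure; that theorem is proved by
quadrature, a limit along an ultrafilter and the Riesz–Markov theorem. -/

/-- The Cauchy–Binet formula. -/
theorem det_mul_eq_sum_orderEmbedding {m N : ℕ} (A : Matrix (Fin m) (Fin N) R)
    (B : Matrix (Fin N) (Fin m) R) :
    (A * B).det = ∑ s : Fin m ↪o Fin N, (A.submatrix id s).det * (B.submatrix s id).det := by
  classical
  have expand : (A * B).det =
      ∑ p : Fin m → Fin N, (∏ i, A i (p i)) * (B.submatrix p id).det := by
    have h : (A * B) = fun i => ∑ l, A i l • B l := by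
      ext i j
      simp [Matrix.mul_apply]
    change detRowAlternating (A * B) = _
    rw [h]
    erw [MultilinearMap.map_sum]
    refine Finset.sum_congr rfl fun p _ => ?_
    erw [MultilinearMap.map_smul_univ]
    rfl
  have restrict : ∑ p : Fin m → Fin N, (∏ i, A i (p i)) * (B.submatrix p id).det =
      ∑ p : Fin m → Fin N with Function.Injective p,
        (∏ i, A i (p i)) * (B.submatrix p id).det := by
    rw [Finset.sum_filter]
    refine Finset.sum_congr rfl fun p _ => ?_
    split_ifs with hp
    · rfl
    · simp only [Function.Injective, not_forall] at hp
      obtain ⟨i, j, hij, hne⟩ := hp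
      rw [Matrix.det_zero_of_row_eq hne (by ext k; simp [hij]), mul_zero]
  have regroup : ∑ p : Fin m → Fin N with Function.Injective p,
        (∏ i, A i (p i)) * (B.submatrix p id).det =
      ∑ x : (Fin m ↪o Fin N) × Equiv.Perm (Fin m),
        (∏ i, A i (x.1 (x.2 i))) * (B.submatrix (x.1 ∘ x.2) id).det := by
    symm
    refine Finset.sum_bij (fun x _ => (x.1 ∘ x.2 : Fin m → Fin N)) ?_ ?_ ?_ ?_
    · intro x _
      simpa using x.1.injective.comp x.2.injective
    · rintro ⟨s, σ⟩ _ ⟨s', σ'⟩ _ h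
      have hs : s = s' := by
        have hr : Set.range s = Set.range s' := by
          rw [← σ.surjective.range_comp s, ← σ'.surjective.range_comp s']
          exact congrArg Set.range h
        exact DFunLike.coe_injective ((s.strictMono.range_inj s'.strictMono).1 hr)
      subst hs
      have : σ = σ' := Equiv.ext fun i => s.injective (congrFun h i)
      rw [this]
    · intro p hp
      have hp : Function.Injective p := by simpa using hp
      -- An injective `p` factors uniquely as an increasing map after a permutation: sort its
      -- values, then undo the sorting.
      refine ⟨(OrderEmbedding.ofStrictMono (p ∘ Tuple.sort p)
        ((Tuple.monotone_sort p).strictMono_of_injective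
          (hp.comp (Tuple.sort p).injective)), (Tuple.sort p)⁻¹), Finset.mem_univ _, ?_⟩
      ext i
      simp
    · intro x _
      rfl
  rw [expand, restrict, regroup, Fintype.sum_prod_type]
  refine Finset.sum_congr rfl fun s _ => ?_
  rw [← Matrix.det_transpose (A.submatrix id s), Matrix.det_apply', Finset.sum_mul]
  refine Finset.sum_congr rfl fun σ _ => ?_
  have : B.submatrix (s ∘ σ) id = (B.submatrix s id).submatrix σ id := rfl
  rw [this, Matrix.det_permute]
  simp only [Matrix.transpose_apply, Matrix.submatrix_apply, id]
  ring

/-- All minors of an infinite matrix lie in a given subsemiring. -/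
def MinorsIn (S : Subsemiring R) (M : Matrix ℕ ℕ R) : Prop :=
  ∀ (m : ℕ) (r c : Fin m ↪o ℕ), matMinor M r c ∈ S

/-- `M` is the product of the infinite matrices `A` and `B`, all the sums being finite. -/
def IsFiniteProd (M A B : Matrix ℕ ℕ R) : Prop :=
  ∀ i j, ∀ᶠ N in Filter.atTop, M i j = ∑ l ∈ range N, A i l * B l j

variable {S : Subsemiring R} {M A B : Matrix ℕ ℕ R}

theorem MinorsIn.transpose (h : MinorsIn S M) : MinorsIn S Mᵀ := fun m r c => by
  have := h m c r
  rwa [matMinor, ← Matrix.det_transpose] at this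

theorem MinorsIn.entry (h : MinorsIn S M) (i j : ℕ) : M i j ∈ S := by
  have := h 1 (OrderEmbedding.ofStrictMono (fun _ => i) (Subsingleton.strictMono _))
    (OrderEmbedding.ofStrictMono (fun _ => j) (Subsingleton.strictMono _))
  simpa [matMinor] using this

theorem MinorsIn.submatrix (h : MinorsIn S M) (f g : ℕ ↪o ℕ) : MinorsIn S (M.submatrix f g) :=
  fun m r c => h m (r.trans f) (c.trans g)

/-- Finitely many entries are involved, so one truncation serves them all and Cauchy–Binet applies.
Only minors of `A` in the given rows are required, which is what an induction on rows can supply. -/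
theorem IsFiniteProd.matMinor_mem (h : IsFiniteProd M A B) {m : ℕ} (r c : Fin m ↪o ℕ)
    (hA : ∀ s : Fin m ↪o ℕ, matMinor A r s ∈ S) (hB : MinorsIn S B) : matMinor M r c ∈ S := by
  have : ∀ᶠ N in Filter.atTop, ∀ i j, M (r i) (c j) = ∑ l ∈ range N, A (r i) l * B l (c j) :=
    Filter.eventually_all.2 fun i => Filter.eventually_all.2 fun j => h (r i) (c j)
  obtain ⟨N, hN⟩ := this.exists
  let A' : Matrix (Fin m) (Fin N) R := A.submatrix r Fin.val
  let B' : Matrix (Fin N) (Fin m) R := B.submatrix Fin.val c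
  have hM : M.submatrix r c = A' * B' := by
    ext i j
    rw [Matrix.submatrix_apply, hN, Matrix.mul_apply, Finset.sum_range]
    rfl
  rw [matMinor, hM, det_mul_eq_sum_orderEmbedding]
  refine sum_mem fun s _ => mul_mem ?_ ?_
  · exact hA (s.trans (Fin.valOrderEmb N))
  · exact hB m (s.trans (Fin.valOrderEmb N)) c

theorem IsFiniteProd.minorsIn (h : IsFiniteProd M A B) (hA : MinorsIn S A) (hB : MinorsIn S B) :
    MinorsIn S M := fun _ r c => h.matMinor_mem r c (hA _ r) hB

/-- The order embedding without its first value. -/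
def dropFirst {m : ℕ} (r : Fin (m + 1) ↪o ℕ) : Fin m ↪o ℕ := (Fin.succOrderEmb m).trans r

theorem matMinor_succ_of_row {m : ℕ} (r c : Fin (m + 1) ↪o ℕ)
    (h : ∀ j, j ≠ 0 → M (r 0) (c j) = 0) :
    matMinor M r c = M (r 0) (c 0) * matMinor M (dropFirst r) (dropFirst c) := by
  rw [matMinor, Matrix.det_succ_row_zero, Finset.sum_eq_single 0]
  · simp only [Fin.val_zero, pow_zero, one_mul, Matrix.submatrix_apply]
    rfl
  · intro j _ hj
    simp [h j hj]
  · simp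

theorem matMinor_succ_of_column {m : ℕ} (r c : Fin (m + 1) ↪o ℕ)
    (h : ∀ i, i ≠ 0 → M (r i) (c 0) = 0) :
    matMinor M r c = M (r 0) (c 0) * matMinor M (dropFirst r) (dropFirst c) := by
  have := matMinor_succ_of_row (M := Mᵀ) c r h
  simp only [matMinor] at this ⊢
  rw [← Matrix.det_transpose, Matrix.transpose_submatrix, this, ← Matrix.det_transpose]
  rfl

/-- A matrix in which no entry has nonzero entries both to its right and below it
has all its minors in `S` as soon as its entries are in `S`. -/
theorem minorsIn_of_forall_right_or_below (hS : ∀ i j, M i j ∈ S)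
    (h : ∀ i j, (∀ j' > j, M i j' = 0) ∨ (∀ i' > i, M i' j = 0)) : MinorsIn S M := by
  intro m
  induction m with
  | zero =>
    intro r c
    simp [matMinor]
  | succ m ih =>
    intro r c
    -- The top left entry is alone in its row or in its column of the minor, so the expansion along
    -- that line has a single term.
    have key : matMinor M r c = M (r 0) (c 0) * matMinor M (dropFirst r) (dropFirst c) := by
      rcases h (r 0) (c 0) with h | h
      · exact matMinor_succ_of_row r c fun j hj =>
          h _ (c.strictMono (Fin.pos_iff_ne_zero.2 hj))
      · exact matMinor_succ_of_column r c fun i hi =>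
          h _ (r.strictMono (Fin.pos_iff_ne_zero.2 hi))
    rw [key]
    exact mul_mem (hS _ _) (ih _ _)

/-- `T` is the output matrix of the production matrix `P`. -/
structure IsOutputMatrix (T P : Matrix ℕ ℕ R) : Prop where
  zero : ∀ k, T 0 k = if k = 0 then 1 else 0
  succ : ∀ n k, ∀ᶠ N in Filter.atTop, T (n + 1) k = ∑ j ∈ range N, T n j * P j k

/-- Induction on a bound for the rows. Row 0 is e₀, so if it occurs it can be split off; once all
rows are positive, they are the preceding rows of `T` multiplied by `P`. -/
theorem IsOutputMatrix.minorsIn {T P : Matrix ℕ ℕ R} (h : IsOutputMatrix T P)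
    (hP : MinorsIn S P) : MinorsIn S T := by
  suffices ∀ (n m : ℕ) (r c : Fin m ↪o ℕ), (∀ i, r i < n) → matMinor T r c ∈ S by
    intro m r c
    obtain ⟨n, hn⟩ := (Finset.univ.image r).exists_nat_subset_range
    exact this n m r c fun i => by
      simpa using hn (Finset.mem_image_of_mem r (Finset.mem_univ i))
  intro n
  induction n with
  | zero =>
    intro m r c hr
    obtain rfl : m = 0 := by
      by_contra hm
      exact absurd (hr ⟨0, Nat.pos_of_ne_zero hm⟩) (by simp)
    simp [matMinor]
  | succ n ih =>
    have pos : ∀ (m : ℕ) (r c : Fin m ↪o ℕ), (∀ i, r i < n + 1) → (∀ i, 0 < r i) →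
        matMinor T r c ∈ S := by
      intro m r c hr hr0
      let r' : Fin m ↪o ℕ := OrderEmbedding.ofStrictMono (fun i => r i - 1) fun i j hij => by
        have h1 := r.strictMono hij
        have h2 := hr0 i
        simp only
        omega
      have hr' : ∀ i, r i = r' i + 1 := fun i => by
        have := hr0 i
        change r i = r i - 1 + 1
        omega
      have e : matMinor T r c = matMinor (Matrix.of fun i j => T (i + 1) j) r' c := by
        simp only [matMinor]
        congr 1
        ext i j
        simp [hr']
      rw [e]
      have hprod : IsFiniteProd (Matrix.of fun i j => T (i + 1) j) T P := fun i j => h.succ i j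
      refine hprod.matMinor_mem r' c (fun s => ih m r' s fun i => ?_) hP
      have := hr i
      rw [hr'] at this
      omega
    intro m r c hr
    cases m with
    | zero => simp [matMinor]
    | succ m =>
      by_cases hr0 : r 0 = 0
      · have hrow : ∀ j, j ≠ 0 → T (r 0) (c j) = 0 := fun j hj => by
          have := c.strictMono (Fin.pos_iff_ne_zero.2 hj)
          rw [hr0, h.zero, if_neg (by omega)]
        rw [matMinor_succ_of_row r c hrow]
        refine mul_mem ?_ (pos m _ _ (fun i => hr _) fun i => ?_)
        · rw [hr0, h.zero]
          split_ifs
          · exact S.one_mem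
          · exact S.zero_mem
        · have := r.strictMono (Fin.succ_pos i)
          exact lt_of_le_of_lt (Nat.zero_le _) this
      · refine pos _ r c hr fun i => ?_
        exact lt_of_lt_of_le (Nat.pos_of_ne_zero hr0) (r.monotone (Fin.zero_le i))

/-- The columns `P ^ j e_0` of a row-finite matrix with `P_{k,l} = 0` for `l > k + 1`. -/
def columnPowers (P : Matrix ℕ ℕ R) : ℕ → ℕ → R
  | 0 => fun k => if k = 0 then 1 else 0
  | j + 1 => fun k => ∑ l ∈ range (k + 2), P k l * columnPowers P j l

theorem sum_range_eq_of_le {α : Type*} [AddCommMonoid α] {f : ℕ → α} {a N : ℕ} (hN : a ≤ N)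
    (hf : ∀ l, a ≤ l → f l = 0) : ∑ l ∈ range N, f l = ∑ l ∈ range a, f l := by
  refine (Finset.sum_subset (by simpa using hN) fun l _ hl => hf l ?_).symm
  simpa using hl

theorem IsOutputMatrix.upper_eq_zero {T P : Matrix ℕ ℕ R} (h : IsOutputMatrix T P)
    (hP : ∀ k l, k + 1 < l → P k l = 0) : ∀ n k, n < k → T n k = 0 := by
  intro n
  induction n with
  | zero =>
    intro k hk
    rw [h.zero, if_neg (by omega)]
  | succ n ih =>
    intro k hk
    obtain ⟨N, hN⟩ := (h.succ n k).exists
    rw [hN]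
    refine Finset.sum_eq_zero fun j _ => ?_
    rcases Nat.lt_or_ge n j with hj | hj
    · rw [ih j hj, zero_mul]
    · rw [hP j k (by omega), mul_zero]

theorem IsOutputMatrix.succ_eq_sum {T P : Matrix ℕ ℕ R} (h : IsOutputMatrix T P)
    (hP : ∀ k l, k + 1 < l → P k l = 0) (n k : ℕ) :
    T (n + 1) k = ∑ j ∈ range (n + 1), T n j * P j k := by
  obtain ⟨N, hN, hle⟩ := ((h.succ n k).and (Filter.eventually_ge_atTop (n + 1))).exists
  rw [hN, sum_range_eq_of_le hle fun l hl => by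
    rw [h.upper_eq_zero hP n l (by omega), zero_mul]]

/-- Both sides equal e₀ᵀ P^(i+j) e₀. The induction moves one factor `P` at a time from the row
vector to the column vector. -/
theorem IsOutputMatrix.hankel_eq_sum {T P : Matrix ℕ ℕ R} (h : IsOutputMatrix T P)
    (hP : ∀ k l, k + 1 < l → P k l = 0) (j : ℕ) :
    ∀ i, T (i + j) 0 = ∑ k ∈ range (i + 1), T i k * columnPowers P j k := by
  induction j with
  | zero =>
    intro i
    simp [columnPowers]
  | succ j ih =>
    intro i
    rw [show i + (j + 1) = (i + 1) + j by ring, ih]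
    simp_rw [h.succ_eq_sum hP i, Finset.sum_mul, columnPowers, Finset.mul_sum]
    rw [Finset.sum_comm]
    refine Finset.sum_congr rfl fun k hk => ?_
    rw [Finset.mem_range] at hk
    rw [← sum_range_eq_of_le (a := k + 2) (N := i + 1 + 1) (by omega) fun l hl => by
      rw [hP k l (by omega), zero_mul, mul_zero]]
    exact Finset.sum_congr rfl fun l _ => mul_assoc _ _ _

theorem IsOutputMatrix.minorsIn_hankel {T P : Matrix ℕ ℕ R} (h : IsOutputMatrix T P)
    (hP : ∀ k l, k + 1 < l → P k l = 0) (hPS : MinorsIn S P) :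
    MinorsIn S (hankelMatrix fun n => T n 0) := by
  -- The vectors Pʲ e₀, taken as rows, form the output matrix of the transpose, so the second Hankel
  -- factor is covered by the same theorem as the first.
  have hV : IsOutputMatrix (Matrix.of fun j k => columnPowers P j k) Pᵀ := by
    refine ⟨fun k => rfl, fun n k => ?_⟩
    filter_upwards [Filter.eventually_ge_atTop (k + 2)] with N hN
    rw [sum_range_eq_of_le hN fun l hl => by simp [hP k l (by omega)]]
    exact (Finset.sum_congr rfl fun l _ => mul_comm (P k l) (columnPowers P n l) :
      ∑ l ∈ range (k + 2), P k l * columnPowers P n l = _)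
  have hprod : IsFiniteProd (hankelMatrix fun n => T n 0) T
      (Matrix.of fun j k => columnPowers P j k)ᵀ := fun i j => by
    filter_upwards [Filter.eventually_ge_atTop (i + 1)] with N hN
    rw [sum_range_eq_of_le hN fun l hl => by
      rw [h.upper_eq_zero hP i l (by omega), zero_mul]]
    exact h.hankel_eq_sum hP j i
  exact hprod.minorsIn (h.minorsIn hPS) (hV.minorsIn hPS.transpose).transpose

theorem MinorsIn.const_mul {s : R} (hs : s ∈ S) (h : MinorsIn S M) :
    MinorsIn S (Matrix.of fun i j => s * M i j) := fun m r c => by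
  have : (Matrix.of fun i j => s * M i j).submatrix r c = s • M.submatrix r c := rfl
  rw [matMinor, this, Matrix.det_smul]
  exact mul_mem (pow_mem hs _) (h m r c)

end MinorsIn

/-! ### The production matrix -/

section Production

open Finset Matrix

variable {R : Type*} [CommRing R]

/-- The weighted Toeplitz matrix `[(j! / l!) φ_{j-l} a^{j-l}]`. -/
noncomputable def weightedToeplitz [Algebra ℝ R] (φ : ℕ → ℝ) (a : R) : Matrix ℕ ℕ R :=
  Matrix.of fun j l => if l ≤ j then
    algebraMap ℝ R ((j.factorial : ℝ) / l.factorial * φ (j - l)) * a ^ (j - l) else 0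

/-- Formally a diagonal conjugation, but `a` need not be invertible, so the Leibniz expansions are
compared term by term. A term is nonzero only if `c i ≤ r (σ i)` for all `i`, and then the truncated
subtraction in the exponent is exact. -/
theorem matMinor_weightedToeplitz [Algebra ℝ R] (φ : ℕ → ℝ) (a : R) {m : ℕ} (r c : Fin m ↪o ℕ) :
    matMinor (weightedToeplitz φ a) r c =
      algebraMap ℝ R ((∏ i, ((r i).factorial : ℝ)) / (∏ i, ((c i).factorial : ℝ)) *
        matMinor (toeplitzMatrix φ) r c) * a ^ (∑ i, r i - ∑ i, c i) := by
  rw [matMinor, matMinor, Matrix.det_apply', Matrix.det_apply', Finset.mul_sum, map_sum,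
    Finset.sum_mul]
  refine Finset.sum_congr rfl fun σ _ => ?_
  by_cases h : ∀ i, c i ≤ r (σ i)
  · have h1 : ∀ i, (weightedToeplitz φ a).submatrix r c (σ i) i =
        algebraMap ℝ R (((r (σ i)).factorial : ℝ) / (c i).factorial * φ (r (σ i) - c i)) *
          a ^ (r (σ i) - c i) := fun i => by
      simp [weightedToeplitz, h i]
    have h2 : ∀ i, (toeplitzMatrix φ).submatrix r c (σ i) i = φ (r (σ i) - c i) := fun i => by
      simp [toeplitzMatrix, h i]
    simp_rw [h1, h2]
    rw [Finset.prod_mul_distrib, Finset.prod_pow_eq_pow_sum,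
      Finset.sum_tsub_distrib _ (fun i _ => h i), ← map_prod, Finset.prod_mul_distrib,
      Finset.prod_div_distrib, Equiv.sum_comp σ (fun i => r i),
      Equiv.prod_comp σ (fun i => ((r i).factorial : ℝ))]
    simp only [map_mul, map_intCast]
    ring
  · push Not at h
    obtain ⟨i, hi⟩ := h
    have h1 : (weightedToeplitz φ a).submatrix r c (σ i) i = 0 := by
      simp [weightedToeplitz, hi]
    have h2 : (toeplitzMatrix φ).submatrix r c (σ i) i = 0 := by
      simp [toeplitzMatrix, hi]
    have h3 : ∏ i, (weightedToeplitz φ a).submatrix r c (σ i) i = 0 :=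
      Finset.prod_eq_zero (Finset.mem_univ i) h1
    have h4 : ∏ i, (toeplitzMatrix φ).submatrix r c (σ i) i = 0 :=
      Finset.prod_eq_zero (Finset.mem_univ i) h2
    rw [h3, h4]
    simp

/-- The matrix of the operator `(1 + a s) (∂ + b) + c` in the basis `s ^ k / k!`. -/
def shefferTridiagonal (a b c : R) : Matrix ℕ ℕ R :=
  Matrix.of fun l k => if l = k then a * k + b + c else if l + 1 = k then 1
    else if l = k + 1 then a * b * l else 0

/-- The production matrix of the Sheffer triangle. -/
noncomputable def shefferProduction [Algebra ℝ R] (φ : ℕ → ℝ) (a b c : R) : Matrix ℕ ℕ R :=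
  Matrix.of fun j k => ∑ l ∈ range (j + 1), weightedToeplitz φ a j l * shefferTridiagonal a b c l k

/-- A staircase matrix whose minors are monomials in its entries. -/
def staircaseMatrix (p q : R) (w : ℕ → R) : Matrix ℕ ℕ R :=
  Matrix.of fun t k => if t = 2 * k then p else if t = 2 * k + 1 then q
    else if t + 1 = 2 * k then w k else 0

variable {S : Subsemiring R}

theorem minorsIn_staircaseMatrix {p q : R} {w : ℕ → R} (hp : p ∈ S) (hq : q ∈ S)
    (hw : ∀ k, w k ∈ S) : MinorsIn S (staircaseMatrix p q w) := by
  refine minorsIn_of_forall_right_or_below (fun i j => ?_) fun i j => ?_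
  · simp only [staircaseMatrix, Matrix.of_apply]
    split_ifs
    exacts [hp, hq, hw _, S.zero_mem]
  · simp only [staircaseMatrix, Matrix.of_apply]
    -- Column `j` is supported on rows 2j-1, 2j, 2j+1, so successive columns overlap in a single
    -- row.
    rcases Nat.lt_or_ge (2 * j) i with h | h
    · right
      intro i' hi'
      rw [if_neg (by omega), if_neg (by omega), if_neg (by omega)]
    · left
      intro j' hj'
      rw [if_neg (by omega), if_neg (by omega), if_neg (by omega)]

/-- The intermediate index 2l carries `c`, while 2l-1 and 2l+1 carry the two factors of (1 + a s)(∂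
+ b): on the diagonal the paths add up to c + b + a k, and next to it there is one path, of weight 1
or a b l. -/
theorem minorsIn_shefferTridiagonal {a b c : R} (ha : a ∈ S) (hb : b ∈ S) (hc : c ∈ S) :
    MinorsIn S (shefferTridiagonal a b c) := by
  have hprod : IsFiniteProd (shefferTridiagonal a b c)
      (staircaseMatrix c 1 fun k => a * k)ᵀ (staircaseMatrix 1 b fun _ => 1) := fun l k => by
    filter_upwards [Filter.eventually_ge_atTop (2 * k + 2)] with N hN
    have hY : ∀ t, staircaseMatrix 1 b (fun _ => 1) t k =
        (if t = 2 * k then (1 : R) else 0) + (if t = 2 * k + 1 then b else 0) +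
          (if t + 1 = 2 * k then 1 else 0) := fun t => by
      simp only [staircaseMatrix, Matrix.of_apply]
      split_ifs <;> first | omega | simp
    simp_rw [hY, mul_add, Finset.sum_add_distrib, mul_ite, mul_one, mul_zero]
    rw [Finset.sum_ite_eq', if_pos (by simp; omega), Finset.sum_ite_eq', if_pos (by simp; omega)]
    have h3 : (∑ t ∈ range N, if t + 1 = 2 * k then
        (staircaseMatrix c 1 fun k => a * (k : R))ᵀ l t else 0) =
        if k = 0 then 0 else (staircaseMatrix c 1 fun k => a * (k : R))ᵀ l (2 * k - 1) := by
      split_ifs with hk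
      · exact Finset.sum_eq_zero fun t _ => if_neg (by omega)
      · rw [Finset.sum_eq_single (2 * k - 1)]
        · rw [if_pos (by omega)]
        · intro t _ ht
          exact if_neg (by omega)
        · intro h
          exact absurd (Finset.mem_range.2 (by omega)) h
    rw [h3]
    simp only [shefferTridiagonal, staircaseMatrix, Matrix.of_apply, Matrix.transpose_apply]
    rcases lt_trichotomy l k with h | h | h
    · rcases eq_or_ne (l + 1) k with h' | h'
      · rw [if_neg (by omega), if_pos h', if_neg (by omega), if_neg (by omega),
          if_neg (by omega), if_neg (by omega), if_neg (by omega), if_neg (by omega),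
          if_neg (by omega), if_neg (by omega), if_pos (by omega)]
        ring
      · rw [if_neg (by omega), if_neg h', if_neg (by omega), if_neg (by omega),
          if_neg (by omega), if_neg (by omega), if_neg (by omega), if_neg (by omega),
          if_neg (by omega)]
        split_ifs <;> first | omega | ring
    · subst h
      rw [if_pos rfl, if_pos rfl, if_neg (by omega), if_pos rfl]
      split_ifs with h1 h2 h3 h4
      · subst h1
        simp
        ring
      · omega
      · omega
      · ring
      · omega
    · rcases eq_or_ne l (k + 1) with h' | h'
      · subst h'
        rw [if_neg (by omega), if_neg (by omega), if_pos rfl, if_neg (by omega),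
          if_neg (by omega), if_neg (by omega), if_neg (by omega), if_neg (by omega),
          if_pos (by omega)]
        split_ifs <;> first | omega | ring
      · split_ifs <;> first | omega | ring
  exact hprod.minorsIn (minorsIn_staircaseMatrix hc S.one_mem fun k =>
    mul_mem ha (natCast_mem S k)).transpose
      (minorsIn_staircaseMatrix S.one_mem hb fun _ => S.one_mem)

theorem minorsIn_shefferProduction [Algebra ℝ R] (hS : ∀ x : ℝ, 0 ≤ x → algebraMap ℝ R x ∈ S) {φ : ℕ → ℝ}
    (hφ : IsTP (toeplitzMatrix φ)) {a b c : R} (ha : a ∈ S) (hb : b ∈ S) (hc : c ∈ S) :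
    MinorsIn S (shefferProduction φ a b c) := by
  have hE : MinorsIn S (weightedToeplitz φ a) := fun m r c => by
    rw [matMinor_weightedToeplitz]
    exact mul_mem (hS _ (mul_nonneg (by positivity) (hφ m r c))) (pow_mem ha _)
  have hprod : IsFiniteProd (shefferProduction φ a b c) (weightedToeplitz φ a)
      (shefferTridiagonal a b c) := fun j k => by
    filter_upwards [Filter.eventually_ge_atTop (j + 1)] with N hN
    rw [sum_range_eq_of_le hN fun l hl => by
      rw [weightedToeplitz, Matrix.of_apply, if_neg (by omega), zero_mul]]
    rfl
  exact hprod.minorsIn hE (minorsIn_shefferTridiagonal ha hb hc)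

theorem shefferProduction_eq_zero [Algebra ℝ R] (φ : ℕ → ℝ) (a b c : R) (j k : ℕ) (h : j + 1 < k) :
    shefferProduction φ a b c j k = 0 := by
  rw [shefferProduction, Matrix.of_apply]
  refine Finset.sum_eq_zero fun l hl => ?_
  rw [Finset.mem_range] at hl
  rw [shefferTridiagonal, Matrix.of_apply, if_neg (by omega), if_neg (by omega),
    if_neg (by omega), mul_zero]

end Production

/-! ### Sheffer triangles as output matrices -/

section Series

open Finset Matrix PowerSeries

variable {R : Type*} [CommRing R]

theorem coeff_mul_pow_eq_zero {F : PowerSeries R} (hF : constantCoeff F = 0) (K : PowerSeries R)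
    {n k : ℕ} (h : n < k) : coeff n (K * F ^ k) = 0 :=
  X_pow_dvd_iff.1 (dvd_mul_of_dvd_right (pow_dvd_pow_of_dvd (X_dvd_iff.2 hF) k) K) n h

/-- F^j has order at least j, so composition becomes a finite sum at each coefficient. This is the
fundamental theorem of Riordan-type arrays in coefficient form. -/
theorem coeff_mul_subst {F : PowerSeries R} (hF : constantCoeff F = 0) (K ψ : PowerSeries R)
    (n : ℕ) : coeff n (K * ψ.subst F) = ∑ j ∈ range (n + 1), coeff j ψ * coeff n (K * F ^ j) := by
  have h : ∀ q ≤ n, coeff q (ψ.subst F) = ∑ j ∈ range (n + 1), coeff j ψ * coeff q (F ^ j) := by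
    intro q hq
    rw [coeff_subst' (HasSubst.of_constantCoeff_zero' hF), finsum_eq_sum_of_support_subset]
    · rfl
    · intro j hj
      simp only [Finset.coe_range, Set.mem_Iio]
      by_contra hjn
      refine hj ?_
      have := coeff_mul_pow_eq_zero hF 1 (n := q) (k := j) (by omega)
      rw [one_mul] at this
      simp [this]
  rw [PowerSeries.coeff_mul, Finset.sum_congr rfl fun p hp => by
    rw [h p.2 (by have := HasAntidiagonal.mem_antidiagonal.1 hp; omega)]]
  simp_rw [Finset.mul_sum]
  rw [Finset.sum_comm]
  refine Finset.sum_congr rfl fun j _ => ?_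
  rw [PowerSeries.coeff_mul, Finset.mul_sum]
  exact Finset.sum_congr rfl fun p _ => by ring

/-- By the two differential equations, (H F^k)' = Φ H ((a k + b + c) F^k + k F^(k-1) + a b F^(k+1)),
which is column `k` of the tridiagonal matrix. Multiplication by Φ, assumed to act as φ(aF), is the
weighted Toeplitz factor. -/
theorem isOutputMatrix_of_derivative [Algebra ℝ R] {F H Φ : PowerSeries R} {a b c : R}
    {φ : ℕ → ℝ} (hF0 : constantCoeff F = 0) (hH0 : constantCoeff H = 1)
    (hF : derivative R F = (1 + C a * F) * Φ)
    (hH : derivative R H = H * (C c + C b * (1 + C a * F)) * Φ)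
    (hΦ : ∀ (K : PowerSeries R) (n : ℕ), coeff n (K * Φ) =
      ∑ j ∈ range (n + 1), algebraMap ℝ R (φ j) * a ^ j * coeff n (K * F ^ j)) :
    IsOutputMatrix (Matrix.of fun n k => algebraMap ℝ R ((n.factorial : ℝ) / k.factorial) *
      coeff n (H * F ^ k)) (shefferProduction φ a b c) := by
  have hfac : ∀ k : ℕ, (k.factorial : ℝ) ≠ 0 := fun k => by positivity
  refine ⟨fun k => ?_, fun n k => ?_⟩
  · rcases Nat.eq_zero_or_pos k with rfl | hk
    · simp [hH0]
    · simp [hF0, hk.ne']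
  · have hTE : ∀ l N, n + 1 ≤ N → ∑ j ∈ range N,
        algebraMap ℝ R ((n.factorial : ℝ) / j.factorial) * coeff n (H * F ^ j) *
          weightedToeplitz φ a j l =
        algebraMap ℝ R ((n.factorial : ℝ) / l.factorial) * coeff n (H * F ^ l * Φ) := by
      intro l N hN
      have hz : ∀ j, n + 1 ≤ j → algebraMap ℝ R ((n.factorial : ℝ) / j.factorial) *
          coeff n (H * F ^ j) * weightedToeplitz φ a j l = 0 := fun j hj => by
        rw [coeff_mul_pow_eq_zero hF0 H (by omega)]
        ring
      -- The range is re-extended by vanishing terms to length l + (n+1), so that the first l terms,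
      -- zero by triangularity, split off and the rest match `hΦ`.
      rw [sum_range_eq_of_le hN hz, ← sum_range_eq_of_le (N := l + (n + 1)) (by omega) hz,
        Finset.sum_range_add, Finset.sum_eq_zero, zero_add, hΦ, Finset.mul_sum]
      · refine Finset.sum_congr rfl fun i _ => ?_
        rw [weightedToeplitz, Matrix.of_apply, if_pos (by omega), Nat.add_sub_cancel_left,
          mul_assoc H, ← pow_add,
          show (n.factorial : ℝ) / l.factorial = (n.factorial : ℝ) / (l + i).factorial *
            ((l + i).factorial / l.factorial) by field_simp [hfac l, hfac (l + i)]]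
        simp only [map_mul]
        ring
      · intro j hj
        rw [Finset.mem_range] at hj
        rw [weightedToeplitz, Matrix.of_apply, if_neg (by omega), mul_zero]
    filter_upwards [Filter.eventually_ge_atTop (n + k + 3)] with N hN
    simp only [Matrix.of_apply]
    have hP : ∀ j ∈ range N, shefferProduction φ a b c j k =
        ∑ l ∈ range N, weightedToeplitz φ a j l * shefferTridiagonal a b c l k := fun j hj => by
      rw [sum_range_eq_of_le (a := j + 1) (by simpa using hj) fun l hl => by
        rw [weightedToeplitz, Matrix.of_apply, if_neg (by omega), zero_mul]]
      rfl
    rw [Finset.sum_congr rfl fun j hj => by rw [hP j hj, Finset.mul_sum], Finset.sum_comm]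
    simp_rw [← mul_assoc, ← Finset.sum_mul]
    rw [Finset.sum_congr rfl fun l _ => by rw [hTE l N (by omega)]]
    have hB : ∀ l, shefferTridiagonal a b c l k = (if l = k then a * k + b + c else 0) +
        (if l + 1 = k then 1 else 0) + (if l = k + 1 then a * b * (k + 1) else 0) := fun l => by
      rw [shefferTridiagonal, Matrix.of_apply]
      split_ifs with h1 h2 h3 h4 h5 h6 <;> first | omega | simp [*]
    simp_rw [hB, mul_add, Finset.sum_add_distrib, mul_ite, mul_zero]
    rw [Finset.sum_ite_eq', if_pos (by simp; omega), Finset.sum_ite_eq', if_pos (by simp; omega)]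
    have hd : ((n : R) + 1) * coeff (n + 1) (H * F ^ k) =
        coeff n (derivative R (H * F ^ k)) := by
      rw [coeff_derivative, mul_comm]
    have hsucc : algebraMap ℝ R (((n + 1).factorial : ℝ) / k.factorial) *
        coeff (n + 1) (H * F ^ k) = algebraMap ℝ R ((n.factorial : ℝ) / k.factorial) *
          coeff n (derivative R (H * F ^ k)) := by
      rw [← hd, Nat.factorial_succ, Nat.cast_mul, mul_div_assoc, map_mul]
      simp
      ring
    rw [hsucc]
    have hstep : ∀ j : ℕ, algebraMap ℝ R ((n.factorial : ℝ) / (j + 1).factorial) * (j + 1 : R) =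
        algebraMap ℝ R ((n.factorial : ℝ) / j.factorial) := fun j => by
      have : (j + 1 : R) = algebraMap ℝ R (j + 1) := by simp
      rw [this, ← map_mul]
      congr 1
      rw [Nat.factorial_succ]
      have := hfac j
      push_cast
      field_simp
    have hk1 := hstep k
    -- Column 0 is separate because it has no superdiagonal entry, the term k F^(k-1) being absent.
    rcases k with _ | k
    · rw [Finset.sum_eq_zero fun l _ => if_neg (by omega)]
      have : derivative R (H * F ^ 0) = C (b + c) * (H * F ^ 0 * Φ) +
          C (a * b) * (H * F ^ (0 + 1) * Φ) := by
        rw [pow_zero, mul_one, hH]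
        simp only [map_add, map_mul]
        ring
      rw [this, map_add, coeff_C_mul, coeff_C_mul]
      simp only [Nat.factorial, Nat.cast_zero]
      push_cast
      ring
    · rw [Finset.sum_eq_single k (fun l _ hl => if_neg (by omega))
        (fun h => absurd (Finset.mem_range.2 (by omega)) h), if_pos rfl]
      have : derivative R (H * F ^ (k + 1)) =
          C (a * ((k + 1 : ℕ) : R) + b + c) * (H * F ^ (k + 1) * Φ) +
          C ((k + 1 : ℕ) : R) * (H * F ^ k * Φ) + C (a * b) * (H * F ^ (k + 1 + 1) * Φ) := by
        rw [Derivation.leibniz, derivative_pow, hH, hF]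
        simp only [map_add, map_mul, map_natCast, smul_eq_mul, Nat.add_sub_cancel]
        ring
      rw [this, map_add, map_add, coeff_C_mul, coeff_C_mul, coeff_C_mul, ← hk1]
      rw [← hstep k, ← hk1]
      push_cast
      ring

end Series

/-! ### Exponential, binomial and rescaled series; coefficients of Sheffer triangles -/

section Sheffer

open Finset Matrix PowerSeries

variable {R : Type*} [CommRing R]

theorem algebraMap_rat_eq_real [Algebra ℝ R] [Algebra ℚ R] (x : ℚ) :
    algebraMap ℚ R x = algebraMap ℝ R (x : ℝ) := by
  have : algebraMap ℚ R = (algebraMap ℝ R).comp (algebraMap ℚ ℝ) := Subsingleton.elim _ _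
  rw [this]
  simp

theorem coeff_mul_expSeries [Algebra ℚ R] {F : PowerSeries R} (hF : constantCoeff F = 0)
    (c : R) (K : PowerSeries R) (n : ℕ) : coeff n (K * expSeries c F) =
      ∑ j ∈ range (n + 1), algebraMap ℚ R (1 / j.factorial) * c ^ j * coeff n (K * F ^ j) := by
  rw [expSeries, coeff_mul_subst (by simp [hF])]
  refine Finset.sum_congr rfl fun j _ => ?_
  rw [mul_pow, ← map_pow, mul_left_comm, coeff_C_mul, coeff_exp, mul_assoc]

theorem constantCoeff_expSeries [Algebra ℚ R] {F : PowerSeries R} (hF : constantCoeff F = 0)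
    (c : R) : constantCoeff (expSeries c F) = 1 := by
  have := coeff_mul_expSeries hF c 1 0
  simpa using this

theorem expSeries_zero [Algebra ℚ R] {F : PowerSeries R} (hF : constantCoeff F = 0) :
    expSeries (0 : R) F = 1 := by
  ext n
  have := coeff_mul_expSeries hF 0 1 n
  rw [one_mul, Finset.sum_eq_single 0 (by intro j _ hj; simp [hj]) (by simp)] at this
  simpa using this

theorem constantCoeff_map_eq_zero [Algebra ℝ R] {f : PowerSeries ℝ} (hf0 : constantCoeff f = 0) :
    constantCoeff (f.map (algebraMap ℝ R)) = 0 := by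
  rw [← coeff_zero_eq_constantCoeff_apply, coeff_map, coeff_zero_eq_constantCoeff_apply, hf0,
    map_zero]

theorem derivative_expSeries [Algebra ℚ R] {F : PowerSeries R} (hF : constantCoeff F = 0) (c : R) :
    derivative R (expSeries c F) = C c * derivative R F * expSeries c F := by
  have hs : HasSubst (C c * F) := HasSubst.of_constantCoeff_zero' (by simp [hF])
  rw [expSeries, derivative_subst hs, derivative_exp, Derivation.leibniz, mul_comm]
  simp

theorem constantCoeff_onePlusPow [BinomialRing R] {F : PowerSeries R} (hF : constantCoeff F = 0)
    (γ : R) : constantCoeff (onePlusPow γ F) = 1 := by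
  have := coeff_mul_subst hF 1 (binomialSeries R γ) 0
  simpa [onePlusPow] using this

/-- The differential equation of (1+t)^γ, equivalent to (n+1) binom(γ, n+1) = (γ-n) binom(γ, n). It
makes sense for an indeterminate γ. -/
theorem one_add_X_mul_derivative_binomialSeries [BinomialRing R] (γ : R) :
    (1 + X) * derivative R (binomialSeries R γ) = C γ * binomialSeries R γ := by
  have key : ∀ n : ℕ, ((n : R) + 1) * Ring.choose γ (n + 1) = (γ - n) * Ring.choose γ n := by
    intro n
    have h := Ring.choose_smul_choose γ (Nat.le_succ n)
    simp only [Nat.succ_eq_add_one, Nat.choose_succ_self_right, nsmul_eq_mul,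
      Nat.add_sub_cancel_left, Ring.choose_one_right] at h
    push_cast at h
    rw [h, mul_comm]
  ext n
  rw [add_mul, one_mul, map_add, coeff_C_mul, coeff_derivative]
  simp only [binomialSeries_coeff, smul_eq_mul, mul_one]
  rcases n with _ | n
  · have := key 0
    simp at this ⊢
  · rw [coeff_succ_X_mul, coeff_derivative]
    simp only [binomialSeries_coeff, smul_eq_mul, mul_one]
    have h1 := key (n + 1)
    have h2 := key n
    push_cast at h1 ⊢
    linear_combination h1

theorem derivative_onePlusPow [BinomialRing R] {F Φ : PowerSeries R} (hF : constantCoeff F = 0)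
    (hΦ : derivative R F = (1 + F) * Φ) (γ : R) :
    derivative R (onePlusPow γ F) = C γ * Φ * onePlusPow γ F := by
  have hs : HasSubst F := HasSubst.of_constantCoeff_zero' hF
  have hu : IsUnit (1 + F) := PowerSeries.isUnit_iff_constantCoeff.2 (by simp [hF])
  refine hu.mul_left_cancel ?_
  have h := congrArg (PowerSeries.subst F) (one_add_X_mul_derivative_binomialSeries γ)
  rw [subst_mul hs, subst_mul hs, subst_add hs, subst_X hs] at h
  have h1 : (1 : PowerSeries R).subst F = (1 : PowerSeries R) := by
    rw [← coe_substAlgHom hs, map_one]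
  have h2 : (C γ).subst F = (C γ : PowerSeries R) := subst_C γ
  rw [h1, h2] at h
  rw [onePlusPow, derivative_subst hs, hΦ, ← mul_assoc, h]
  ring

theorem derivative_rescale (v : R) (G : PowerSeries R) :
    derivative R (rescale v G) = C v * rescale v (derivative R G) := by
  ext n
  rw [coeff_derivative, coeff_C_mul, coeff_rescale, coeff_rescale, coeff_derivative]
  ring

/-- The power series `F(v t) / v`, where `F(0) = 0`. -/
noncomputable def rescaleDiv (v : R) (F : PowerSeries R) : PowerSeries R :=
  PowerSeries.mk fun n => v ^ (n - 1) * coeff n F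

/-- Writing F = X E, the series F(vt)/v is X E(vt), so no division by `v` takes place and `v` may be
an indeterminate. -/
theorem coeff_rescale_mul_rescaleDiv_pow {F : PowerSeries R} (hF : constantCoeff F = 0) (v : R)
    (G : PowerSeries R) (n k : ℕ) :
    coeff n (rescale v G * rescaleDiv v F ^ k) = v ^ (n - k) * coeff n (G * F ^ k) := by
  obtain ⟨E, rfl⟩ := X_dvd_iff.2 hF
  have h : rescaleDiv v (X * E) = X * rescale v E := by
    ext n
    rw [rescaleDiv, coeff_mk]
    rcases n with _ | n
    · simp
    · rw [coeff_succ_X_mul, coeff_succ_X_mul, coeff_rescale, Nat.add_sub_cancel]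
  have h1 : rescale v G * rescaleDiv v (X * E) ^ k = X ^ k * rescale v (G * E ^ k) := by
    rw [h, map_mul, map_pow]
    ring
  have h2 : G * (X * E) ^ k = X ^ k * (G * E ^ k) := by ring
  rw [h1, h2, PowerSeries.coeff_X_pow_mul', PowerSeries.coeff_X_pow_mul']
  split_ifs
  · rw [coeff_rescale]
  · simp

theorem rescale_eq_C_mul_rescaleDiv {F : PowerSeries R} (hF : constantCoeff F = 0) (v : R) :
    rescale v F = C v * rescaleDiv v F := by
  ext n
  rw [coeff_rescale, coeff_C_mul, rescaleDiv, coeff_mk]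
  rcases n with _ | n
  · simp [hF]
  · rw [Nat.add_sub_cancel, pow_succ]
    ring

theorem derivative_rescaleDiv (v : R) (F : PowerSeries R) :
    derivative R (rescaleDiv v F) = rescale v (derivative R F) := by
  ext n
  rw [coeff_derivative, rescaleDiv, coeff_mk, coeff_rescale, coeff_derivative, Nat.add_sub_cancel,
    mul_assoc]

theorem constantCoeff_rescaleDiv {F : PowerSeries R} (hF : constantCoeff F = 0) (v : R) :
    constantCoeff (rescaleDiv v F) = 0 := by
  rw [← coeff_zero_eq_constantCoeff_apply, rescaleDiv, coeff_mk, coeff_zero_eq_constantCoeff_apply,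
    hF, mul_zero]

theorem shefferTriangle_eq [Algebra ℝ R] [Algebra ℚ R] {F : PowerSeries R}
    (hF : constantCoeff F = 0) (G : PowerSeries R) (n k : ℕ) :
    shefferTriangle F G n k =
      algebraMap ℝ R ((n.factorial : ℝ) / k.factorial) * coeff n (G * F ^ k) := by
  have hF' : constantCoeff (F.map Polynomial.C) = 0 := by
    rw [← coeff_zero_eq_constantCoeff_apply, coeff_map, coeff_zero_eq_constantCoeff_apply, hF,
      map_zero]
  rw [shefferTriangle, Matrix.of_apply, shefferPoly, coeff_mul_expSeries hF']
  have h1 : ∀ j : ℕ, algebraMap ℚ (Polynomial R) (1 / j.factorial) * Polynomial.X ^ j *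
      coeff n (G.map Polynomial.C * F.map Polynomial.C ^ j) =
      Polynomial.C (algebraMap ℚ R (1 / j.factorial) * coeff n (G * F ^ j)) *
        Polynomial.X ^ j := fun j => by
    rw [← map_pow, ← map_mul (PowerSeries.map _), coeff_map, Polynomial.C_mul,
      Polynomial.algebraMap_apply]
    ring
  simp_rw [h1]
  rw [← Polynomial.C_eq_natCast, Polynomial.coeff_C_mul, Polynomial.finsetSum_coeff]
  simp_rw [Polynomial.coeff_C_mul_X_pow]
  rw [Finset.sum_ite_eq, div_eq_mul_one_div (n.factorial : ℝ), map_mul (algebraMap ℝ R),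
    map_natCast]
  split_ifs with hk
  · rw [algebraMap_rat_eq_real, mul_assoc]
    push_cast
    rfl
  · rw [coeff_mul_pow_eq_zero hF G (by simpa using hk)]
    simp

theorem shefferTriangle_eq_zero [Algebra ℝ R] [Algebra ℚ R] {F : PowerSeries R}
    (hF : constantCoeff F = 0) (G : PowerSeries R) {n k : ℕ} (h : n < k) :
    shefferTriangle F G n k = 0 := by
  rw [shefferTriangle_eq hF, coeff_mul_pow_eq_zero hF G h, mul_zero]

theorem natDegree_shefferPoly_le [Algebra ℝ R] [Algebra ℚ R] {F : PowerSeries R}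
    (hF : constantCoeff F = 0) (G : PowerSeries R) (n : ℕ) :
    (shefferPoly F G n).natDegree ≤ n :=
  Polynomial.natDegree_le_iff_coeff_eq_zero.2 fun _ h => shefferTriangle_eq_zero hF G h

theorem shefferSeq_eq_sum [Algebra ℝ R] [Algebra ℚ R] {F : PowerSeries R}
    (hF : constantCoeff F = 0) (G : PowerSeries R) (q : R) (n : ℕ) :
    shefferSeq F G q n = ∑ k ∈ range (n + 1), shefferTriangle F G n k * q ^ k :=
  Polynomial.eval_eq_sum_range' (Nat.lt_succ_of_le (natDegree_shefferPoly_le hF G n)) q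

theorem shefferRecipSeq_eq_sum [Algebra ℝ R] [Algebra ℚ R] {F : PowerSeries R}
    (hF : constantCoeff F = 0) (G : PowerSeries R) (q : R) (n : ℕ) :
    shefferRecipSeq F G q n = ∑ k ∈ range (n + 1), shefferTriangle F G n k * q ^ (n - k) := by
  have hd : ((shefferPoly F G n).reflect n).natDegree < n + 1 := by
    refine Nat.lt_succ_of_le (Polynomial.natDegree_le_iff_coeff_eq_zero.2 fun k hk => ?_)
    rw [Polynomial.coeff_reflect, Polynomial.revAt_eq_self_of_lt hk]
    exact shefferTriangle_eq_zero hF G hk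
  rw [shefferRecipSeq, Polynomial.eval_eq_sum_range' hd, ← Finset.sum_range_reflect]
  refine Finset.sum_congr rfl fun k hk => ?_
  rw [Finset.mem_range] at hk
  rw [Polynomial.coeff_reflect, Polynomial.revAt_le (by omega),
    show n - (n + 1 - 1 - k) = k by omega, Nat.add_sub_cancel]
  rfl

/-- The bivariate homogenization `∑ₖ S_{n,k}(F, G) u ^ k v ^ (n - k)`. -/
noncomputable def shefferForm [Algebra ℚ R] (F G : PowerSeries R) (u v : R) : ℕ → R :=
  fun n => ∑ k ∈ range (n + 1), shefferTriangle F G n k * (u ^ k * v ^ (n - k))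

/-! ### Production matrices of the Sheffer triangle and of its homogenization -/

section Production

variable [Algebra ℝ R] [Algebra ℚ R] [BinomialRing R] {f φ : PowerSeries ℝ}

/-- With D = F(vt)/v one has D' = (1 + v D) φ(v D), and H = g(vt) exp(u D) has logarithmic
derivative (v γ + (v l + u)(1 + v D)) φ(v D), hence the three parameters. -/
theorem isOutputMatrix_sheffer_rescale (hf0 : constantCoeff f = 0)
    (hf : derivative ℝ f = (1 + f) * φ.subst f) (γ l u v : R) :
    let F := f.map (algebraMap ℝ R)
    let H := rescale v (shefferG γ l F) * expSeries u (rescaleDiv v F)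
    IsOutputMatrix (Matrix.of fun n k => algebraMap ℝ R ((n.factorial : ℝ) / k.factorial) *
      coeff n (H * rescaleDiv v F ^ k))
      (shefferProduction (fun n => coeff n φ) v (v * l + u) (v * γ)) := by
  intro F H
  have hF0 : constantCoeff F = 0 := constantCoeff_map_eq_zero hf0
  have hD0 := constantCoeff_rescaleDiv hF0 v
  set Φ₀ : PowerSeries R := PowerSeries.map (algebraMap ℝ R) (φ.subst f) with hΦ₀
  have hderiv : derivative R F = (1 + F) * Φ₀ := by
    have : derivative R F = (derivative ℝ f).map (algebraMap ℝ R) := by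
      ext n
      simp [F, coeff_derivative]
    rw [this, hf]
    simp [F, Φ₀]
  have hsub : Φ₀ = (φ.map (algebraMap ℝ R)).subst F :=
    PowerSeries.map_subst (HasSubst.of_constantCoeff_zero' hf0) φ
  have hG : derivative R (shefferG γ l F) = (C γ + C l * (1 + F)) * Φ₀ * shefferG γ l F := by
    rw [shefferG, Derivation.leibniz, derivative_onePlusPow hF0 hderiv, derivative_expSeries hF0,
      hderiv]
    simp only [smul_eq_mul]
    ring
  have hD : derivative R (rescaleDiv v F) = (1 + C v * rescaleDiv v F) * rescale v Φ₀ := by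
    rw [derivative_rescaleDiv, hderiv, map_mul, map_add, map_one, rescale_eq_C_mul_rescaleDiv hF0]
  refine isOutputMatrix_of_derivative (Φ := rescale v Φ₀) hD0 ?_ hD ?_ ?_
  · rw [map_mul, constantCoeff_expSeries hD0, mul_one, ← coeff_zero_eq_constantCoeff_apply,
      coeff_rescale, coeff_zero_eq_constantCoeff_apply, shefferG, map_mul,
      constantCoeff_onePlusPow hF0, constantCoeff_expSeries hF0]
    simp
  · rw [Derivation.leibniz, derivative_expSeries hD0, hD, derivative_rescale, hG]
    have hC : ∀ x : R, rescale v (C x) = C x := fun x => by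
      ext n
      rw [coeff_rescale, coeff_C]
      split_ifs with h
      · simp [h]
      · simp
    simp only [smul_eq_mul, map_mul, map_add, map_one, rescale_eq_C_mul_rescaleDiv hF0, hC, H]
    ring
  · intro K n
    have hc : ∀ q ≤ n, coeff q (rescale v Φ₀) = ∑ j ∈ range (n + 1),
        algebraMap ℝ R (coeff j φ) * v ^ j * coeff q (rescaleDiv v F ^ j) := by
      intro q hq
      have h1 := coeff_mul_subst hF0 1 (φ.map (algebraMap ℝ R)) q
      simp only [one_mul, ← hsub] at h1
      rw [← sum_range_eq_of_le (N := n + 1) (by omega) fun j hj => by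
        have := coeff_mul_pow_eq_zero hF0 1 (n := q) (k := j) (by omega)
        rw [one_mul] at this
        rw [this, mul_zero]] at h1
      rw [coeff_rescale, h1, Finset.mul_sum]
      refine Finset.sum_congr rfl fun j _ => ?_
      have h2 := coeff_rescale_mul_rescaleDiv_pow hF0 v 1 q j
      rw [map_one, one_mul, one_mul] at h2
      rw [h2, coeff_map]
      rcases Nat.lt_or_ge q j with hj | hj
      · have := coeff_mul_pow_eq_zero hF0 1 hj
        rw [one_mul] at this
        rw [this]
        ring
      · rw [← Nat.add_sub_cancel' hj, pow_add, Nat.add_sub_cancel_left]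
        ring
    rw [PowerSeries.coeff_mul, Finset.sum_congr rfl fun p hp => by
      rw [hc p.2 (by have := HasAntidiagonal.mem_antidiagonal.1 hp; omega)]]
    simp_rw [Finset.mul_sum]
    rw [Finset.sum_comm]
    refine Finset.sum_congr rfl fun j _ => ?_
    rw [PowerSeries.coeff_mul, Finset.mul_sum]
    exact Finset.sum_congr rfl fun p _ => by ring

theorem isOutputMatrix_shefferTriangle (hf0 : constantCoeff f = 0)
    (hf : derivative ℝ f = (1 + f) * φ.subst f) (γ l : R) :
    IsOutputMatrix (shefferTriangle (f.map (algebraMap ℝ R))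
      (shefferG γ l (f.map (algebraMap ℝ R))))
      (shefferProduction (fun n => coeff n φ) 1 l γ) := by
  have hF0 : constantCoeff (f.map (algebraMap ℝ R)) = 0 := constantCoeff_map_eq_zero hf0
  have h := isOutputMatrix_sheffer_rescale hf0 hf γ l 0 1
  have h1 : rescaleDiv 1 (f.map (algebraMap ℝ R)) = f.map (algebraMap ℝ R) := by
    ext n
    simp [rescaleDiv]
  have h2 : expSeries (0 : R) (f.map (algebraMap ℝ R)) = 1 := expSeries_zero hF0
  simp only [h1, h2, one_mul, mul_one, add_zero, rescale_one, RingHom.id_apply] at h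
  convert h using 1
  ext n k
  exact shefferTriangle_eq hF0 _ n k

theorem isOutputMatrix_shefferForm (hf0 : constantCoeff f = 0)
    (hf : derivative ℝ f = (1 + f) * φ.subst f) (γ l u v : R) :
    ∃ T, IsOutputMatrix T (shefferProduction (fun n => coeff n φ) v (v * l + u) (v * γ)) ∧
      ∀ n, T n 0 = shefferForm (f.map (algebraMap ℝ R))
        (shefferG γ l (f.map (algebraMap ℝ R))) u v n := by
  have hF0 : constantCoeff (f.map (algebraMap ℝ R)) = 0 := constantCoeff_map_eq_zero hf0
  refine ⟨_, isOutputMatrix_sheffer_rescale hf0 hf γ l u v, fun n => ?_⟩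
  rw [Matrix.of_apply, pow_zero, mul_one, coeff_mul_expSeries (constantCoeff_rescaleDiv hF0 v),
    shefferForm, Finset.mul_sum]
  refine Finset.sum_congr rfl fun k _ => ?_
  rw [coeff_rescale_mul_rescaleDiv_pow hF0, shefferTriangle_eq hF0, algebraMap_rat_eq_real,
    div_eq_mul_one_div ((n.factorial : ℝ)) (k.factorial : ℝ),
    map_mul (algebraMap ℝ R)]
  push_cast
  simp only [Nat.factorial_zero, Nat.cast_one, div_one, map_natCast]
  ring

end Production

end Sheffer

/-! ### Log-convexity from Hankel minors -/

section LogConvex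

open Matrix

variable {R : Type*} [CommRing R] {S : Subsemiring R} {a : ℕ → R}

theorem MinorsIn.det_hankel_mem (h : MinorsIn S (hankelMatrix a)) (m i : ℕ) :
    (Matrix.of fun p q : Fin m => a (i + p + q)).det ∈ S :=
  h m (OrderEmbedding.ofStrictMono (fun p => i + p) fun _ _ hpq => Nat.add_lt_add_left hpq i)
    (Fin.valOrderEmb m)

/-- Each iterate is written, without subtraction, in entries and contiguous Hankel minors of order
at most 4. -/
theorem MinorsIn.iterate_logConvexOp_mem (h : MinorsIn S (hankelMatrix a)) {m : ℕ} (hm : m ≤ 3)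
    (i : ℕ) : (logConvexOp^[m] a) i ∈ S := by
  have h1 : ∀ i, a i ∈ S := fun i => by simpa using h.det_hankel_mem 1 i
  have h2 : ∀ i, a i * a (i + 2) - a (i + 1) ^ 2 ∈ S := fun i => by
    convert h.det_hankel_mem 2 i using 1
    rw [Matrix.det_fin_two]
    simp [add_assoc]
    ring
  have e3 : ∀ i, (Matrix.of fun p q : Fin 3 => a (i + p + q)).det =
      a i * (a (i + 2) * a (i + 4) - a (i + 3) ^ 2) - a (i + 1) * (a (i + 1) * a (i + 4) -
        a (i + 2) * a (i + 3)) + a (i + 2) * (a (i + 1) * a (i + 3) - a (i + 2) ^ 2) := fun i => by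
    rw [Matrix.det_fin_three]
    simp [add_assoc]
    ring
  -- The Desnanot–Jacobi identity for a 4 × 4 Hankel matrix, whose two off-diagonal 3 × 3 minors
  -- coincide.
  have e4 : ∀ i, (Matrix.of fun p q : Fin 4 => a (i + p + q)).det *
      (a (i + 2) * a (i + 4) - a (i + 3) ^ 2) =
      (Matrix.of fun p q : Fin 3 => a (i + p + q)).det *
        (Matrix.of fun p q : Fin 3 => a (i + 2 + p + q)).det -
        (Matrix.of fun p q : Fin 3 => a (i + 1 + p + q)).det ^ 2 := fun i => by
    rw [e3, e3, e3, Matrix.det_succ_row_zero]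
    simp only [Fin.sum_univ_succ, Matrix.det_fin_three]
    simp [Fin.succAbove, add_assoc, Fin.lt_def]
    ring
  have l2 : ∀ i, (logConvexOp^[2] a) i =
      a (i + 2) * (Matrix.of fun p q : Fin 3 => a (i + p + q)).det := fun i => by
    rw [e3]
    simp only [Function.iterate_succ, Function.iterate_zero, Function.comp, id, logConvexOp,
      add_assoc, Nat.reduceAdd]
    ring
  interval_cases m
  · exact h1 i
  · exact h2 i
  · rw [l2]
    exact mul_mem (h1 _) (h.det_hankel_mem 3 i)
  -- With D_i the 3 × 3 minor, a_{i+2} a_{i+4} D_i D_{i+2} - a_{i+3}² D_{i+1}² is split by adding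
  -- and subtracting a_{i+3}² D_i D_{i+2}; `e4` then rewrites the second part.
  · have l3 : (logConvexOp^[3] a) i = (a (i + 2) * a (i + 2 + 2) - a (i + 2 + 1) ^ 2) *
        ((Matrix.of fun p q : Fin 3 => a (i + p + q)).det *
          (Matrix.of fun p q : Fin 3 => a (i + 2 + p + q)).det) +
        a (i + 3) ^ 2 * ((Matrix.of fun p q : Fin 4 => a (i + p + q)).det *
          (a (i + 2) * a (i + 2 + 2) - a (i + 2 + 1) ^ 2)) := by
      rw [Function.iterate_succ_apply', logConvexOp, l2, l2, l2]
      simp only [add_assoc, Nat.reduceAdd]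
      have := e4 i
      simp only [add_assoc] at this
      rw [this]
      ring_nf
    rw [l3]
    exact add_mem (mul_mem (h2 _) (mul_mem (h.det_hankel_mem 3 i) (h.det_hankel_mem 3 _)))
      (mul_mem (pow_mem (h1 _) 2) (mul_mem (h.det_hankel_mem 4 i) (h2 _)))

end LogConvex

/-! ### Polynomials with nonnegative coefficients -/

section CoeffNonneg

/-- The subsemiring of polynomials with nonnegative coefficients. -/
def coeffNonnegSubsemiring (σ : Type*) : Subsemiring (MvPolynomial σ ℝ) where
  carrier := {p | CoeffNonneg p}
  mul_mem' {p q} hp hq d := by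
    classical
    rw [MvPolynomial.coeff_mul]
    exact Finset.sum_nonneg fun x _ => mul_nonneg (hp _) (hq _)
  one_mem' d := by
    classical
    rw [MvPolynomial.coeff_one]
    split_ifs <;> simp
  add_mem' {p q} hp hq d := by
    rw [MvPolynomial.coeff_add]
    exact add_nonneg (hp _) (hq _)
  zero_mem' d := by simp

variable {σ : Type*}

theorem C_mem_coeffNonnegSubsemiring {x : ℝ} (hx : 0 ≤ x) :
    algebraMap ℝ (MvPolynomial σ ℝ) x ∈ coeffNonnegSubsemiring σ := fun d => by
  classical
  rw [MvPolynomial.algebraMap_eq, MvPolynomial.coeff_C]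
  split_ifs
  exacts [hx, le_rfl]

theorem X_mem_coeffNonnegSubsemiring (i : σ) : MvPolynomial.X i ∈ coeffNonnegSubsemiring σ :=
  fun d => by
    classical
    rw [MvPolynomial.coeff_X]
    split_ifs <;> simp

end CoeffNonneg

/-! ### Minors of Sheffer triangles and of the associated Hankel matrices -/

section Production

open PowerSeries

variable {R : Type*} [CommRing R] [Algebra ℝ R] [Algebra ℚ R] [BinomialRing R]
  {S : Subsemiring R} {f φ : PowerSeries ℝ}

theorem minorsIn_shefferTriangle (hS : ∀ x : ℝ, 0 ≤ x → algebraMap ℝ R x ∈ S)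
    (hf0 : constantCoeff f = 0) (hf : derivative ℝ f = (1 + f) * φ.subst f) (hφ : IsPF φ)
    {γ l : R} (hγ : γ ∈ S) (hl : l ∈ S) :
    MinorsIn S (shefferTriangle (f.map (algebraMap ℝ R))
      (shefferG γ l (f.map (algebraMap ℝ R)))) :=
  (isOutputMatrix_shefferTriangle hf0 hf γ l).minorsIn
    (minorsIn_shefferProduction hS hφ S.one_mem hl hγ)

theorem minorsIn_hankel_shefferForm (hS : ∀ x : ℝ, 0 ≤ x → algebraMap ℝ R x ∈ S)
    (hf0 : constantCoeff f = 0) (hf : derivative ℝ f = (1 + f) * φ.subst f) (hφ : IsPF φ)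
    {γ l u v : R} (hγ : γ ∈ S) (hl : l ∈ S) (hu : u ∈ S) (hv : v ∈ S) :
    MinorsIn S (hankelMatrix (shefferForm (f.map (algebraMap ℝ R))
      (shefferG γ l (f.map (algebraMap ℝ R))) u v)) := by
  obtain ⟨T, hT, hT0⟩ := isOutputMatrix_shefferForm hf0 hf γ l u v
  rw [← funext hT0]
  exact hT.minorsIn_hankel (shefferProduction_eq_zero _ _ _ _)
    (minorsIn_shefferProduction hS hφ hv (add_mem (mul_mem hv hl) hu) (mul_mem hv hγ))

theorem minorsIn_hankel_shefferSeq (hS : ∀ x : ℝ, 0 ≤ x → algebraMap ℝ R x ∈ S)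
    (hf0 : constantCoeff f = 0) (hf : derivative ℝ f = (1 + f) * φ.subst f) (hφ : IsPF φ)
    {γ l q : R} (hγ : γ ∈ S) (hl : l ∈ S) (hq : q ∈ S) :
    MinorsIn S (hankelMatrix (shefferSeq (f.map (algebraMap ℝ R))
      (shefferG γ l (f.map (algebraMap ℝ R))) q)) := by
  convert minorsIn_hankel_shefferForm hS hf0 hf hφ hγ hl hq S.one_mem using 2
  ext n
  rw [shefferSeq_eq_sum (constantCoeff_map_eq_zero hf0), shefferForm]
  simp

theorem minorsIn_hankel_shefferRecipSeq (hS : ∀ x : ℝ, 0 ≤ x → algebraMap ℝ R x ∈ S)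
    (hf0 : constantCoeff f = 0) (hf : derivative ℝ f = (1 + f) * φ.subst f) (hφ : IsPF φ)
    {γ l q : R} (hγ : γ ∈ S) (hl : l ∈ S) (hq : q ∈ S) :
    MinorsIn S (hankelMatrix (shefferRecipSeq (f.map (algebraMap ℝ R))
      (shefferG γ l (f.map (algebraMap ℝ R))) q)) := by
  convert minorsIn_hankel_shefferForm hS hf0 hf hφ hγ hl S.one_mem hq using 2
  ext n
  rw [shefferRecipSeq_eq_sum (constantCoeff_map_eq_zero hf0), shefferForm]
  simp

theorem shefferG_zero_right (hf0 : constantCoeff f = 0) (γ : R) :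
    shefferG γ 0 (f.map (algebraMap ℝ R)) = onePlusPow γ (f.map (algebraMap ℝ R)) := by
  rw [shefferG, expSeries_zero (constantCoeff_map_eq_zero hf0), mul_one]

end Production

/-! ### The differential equation of f -/

section Inverse

open PowerSeries

variable {f : PowerSeries ℝ}

/-- `f' = (1 + f) φ(f)` for `φ = ((1 + t) f̄'(t))⁻¹`. -/
theorem derivative_eq_one_add_mul_subst (hf0 : constantCoeff f = 0) (hf1 : coeff 1 f ≠ 0) :
    derivative ℝ f = (1 + f) *
      (((1 + X) * derivative ℝ (f.substInvOfIsUnit hf1.isUnit))⁻¹).subst f := by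
  set h := f.substInvOfIsUnit hf1.isUnit with hh
  have hs : HasSubst f := HasSubst.of_constantCoeff_zero' hf0
  have hone : (1 : PowerSeries ℝ).subst f = (1 : PowerSeries ℝ) := by
    rw [← coe_substAlgHom hs, map_one]
  have hchain : (derivative ℝ h).subst f * derivative ℝ f = 1 := by
    rw [← derivative_subst hs, hh, subst_substInvOfIsUnit_left f hf0 hf1.isUnit, derivative_X]
  have h0 : constantCoeff ((1 + X) * derivative ℝ h) ≠ 0 := by
    rw [map_mul, map_add, ← coeff_zero_eq_constantCoeff_apply (derivative ℝ h), coeff_derivative,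
      hh, zero_add, coeff_one_substInvOfIsUnit]
    simpa using hf1
  have hinv := congrArg (PowerSeries.subst f) (PowerSeries.mul_inv_cancel _ h0)
  rw [subst_mul hs, subst_mul hs, subst_add hs, subst_X hs, hone] at hinv
  calc derivative ℝ f = derivative ℝ f * ((1 + f) * (derivative ℝ h).subst f *
        (((1 + X) * derivative ℝ h)⁻¹).subst f) := by rw [hinv, mul_one]
    _ = (derivative ℝ h).subst f * derivative ℝ f * ((1 + f) *
        (((1 + X) * derivative ℝ h)⁻¹).subst f) := by ring
    _ = _ := by rw [hchain, one_mul]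

end Inverse

/-! ### The Stieltjes moment problem -/

section Moments

open Finset Matrix

/-- The finite truncations of the Hankel matrix of `a` are positive semidefinite. -/
def HankelPosSemidef (a : ℕ → ℝ) : Prop :=
  ∀ N : ℕ, (Matrix.of fun i j : Fin N => a (i + j)).PosSemidef

theorem isHermitian_hankel (a : ℕ → ℝ) (N : ℕ) :
    (Matrix.of fun i j : Fin N => a (i + j)).IsHermitian := by
  ext i j
  simp [add_comm]

/-- A Hermitian real matrix with nonnegative principal minors is positive semidefinite. -/
theorem posSemidef_of_principal_minors_nonneg {n : Type*} [Fintype n] [DecidableEq n]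
    {A : Matrix n n ℝ} (hA : A.IsHermitian)
    (h : ∀ s : Finset n, 0 ≤ (A.submatrix (Subtype.val : s → n) (Subtype.val : s → n)).det) :
    A.PosSemidef := by
  rw [hA.posSemidef_iff_eigenvalues_nonneg]
  intro i
  by_contra hi
  have hneg : hA.eigenvalues i < 0 := not_le.1 hi
  set x := hA.eigenvalues i with hx
  set d := Fintype.card n with hd
  have hroot : A.charpoly.eval x = 0 := by
    rw [hA.charpoly_eq, Polynomial.eval_prod]
    exact Finset.prod_eq_zero (Finset.mem_univ i) (by simp [hx])
  rw [Polynomial.eval_eq_sum_range' (n := d + 1)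
    (by rw [Matrix.charpoly_natDegree_eq_dim]; exact Nat.lt_succ_self _),
    ← Finset.sum_range_reflect] at hroot
  have hterm : ∀ k ∈ range (d + 1), A.charpoly.coeff (d + 1 - 1 - k) * x ^ (d + 1 - 1 - k) =
      (-1) ^ d * ((∑ s ∈ Finset.univ.powersetCard k,
        (A.submatrix (Subtype.val : s → n) (Subtype.val : s → n)).det) * (-x) ^ (d - k)) := by
    intro k hk
    have hk' : k ≤ d := by simpa [Nat.lt_succ_iff] using hk
    rw [Nat.add_sub_cancel, Matrix.charpoly_coeff_eq_sum_minors A k hk',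
      show ((-1 : ℝ)) ^ d = (-1) ^ k * (-1) ^ (d - k) by rw [← pow_add, Nat.add_sub_cancel' hk'],
      neg_pow x]
    have : ((-1 : ℝ) ^ (d - k)) * (-1) ^ (d - k) = 1 := by rw [← mul_pow]; simp
    linear_combination (-(-1) ^ k * (∑ s ∈ Finset.univ.powersetCard k,
        (A.submatrix (Subtype.val : s → n) (Subtype.val : s → n)).det) * x ^ (d - k)) * this
  rw [Finset.sum_congr rfl hterm, ← Finset.mul_sum] at hroot
  have hsum := (mul_eq_zero.1 hroot).resolve_left (by simp)
  -- Up to sign, the characteristic polynomial at a negative x is a sum of principal minors times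
  -- powers of -x; all terms are nonnegative and the empty minor contributes (-x)^d > 0.
  have hpos : 0 < ∑ k ∈ range (d + 1), (∑ s ∈ Finset.univ.powersetCard k,
        (A.submatrix (Subtype.val : s → n) (Subtype.val : s → n)).det) * (-x) ^ (d - k) := by
    refine Finset.sum_pos' (fun k _ => mul_nonneg (Finset.sum_nonneg fun s _ => h s)
      (pow_nonneg (by linarith) _)) ⟨0, by simp, ?_⟩
    simp only [Finset.powersetCard_zero, Finset.sum_singleton, Matrix.det_isEmpty, one_mul]
    exact pow_pos (by linarith) _
  exact hpos.ne' hsum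

theorem hankelPosSemidef_of_isTP {a : ℕ → ℝ} (h : IsTP (hankelMatrix a)) :
    HankelPosSemidef a := by
  intro N
  refine posSemidef_of_principal_minors_nonneg (isHermitian_hankel a N) fun s => ?_
  let e : Fin s.card ≃o s := s.orderIsoOfFin rfl
  let r : Fin s.card ↪o ℕ := e.toOrderEmbedding.trans
    ((OrderEmbedding.subtype (· ∈ s)).trans (Fin.valOrderEmb N))
  rw [← Matrix.det_submatrix_equiv_self e.toEquiv]
  exact h s.card r r

theorem isTP_hankel_succ {a : ℕ → ℝ} (h : IsTP (hankelMatrix a)) :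
    IsTP (hankelMatrix fun n => a (n + 1)) := by
  have hs := MinorsIn.submatrix (S := Subsemiring.nonneg ℝ) (M := hankelMatrix a) h
    (OrderEmbedding.ofStrictMono (· + 1) fun _ _ h => Nat.add_lt_add_right h 1) (RelEmbedding.refl _)
  have e : (hankelMatrix fun n => a (n + 1)) = (hankelMatrix a).submatrix (· + 1) id := by
    ext i j
    change a (i + j + 1) = a (i + 1 + j)
    congr 1
    omega
  rw [e]
  exact hs

open scoped MatrixOrder Matrix.Norms.L2Operator in
theorem exists_isUnit_eq_conjTranspose_mul_self {n : Type*} [Fintype n] [DecidableEq n]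
    {A : Matrix n n ℝ} (hA : A.PosDef) : ∃ B : Matrix n n ℝ, IsUnit B ∧ A = Bᴴ * B := by
  obtain ⟨B, hB⟩ := CStarAlgebra.nonneg_iff_eq_star_mul_self.mp hA.posSemidef.nonneg
  refine ⟨B, ?_, hB⟩
  have := hA.isUnit
  rw [hB, Matrix.isUnit_iff_isUnit_det, Matrix.det_mul] at this
  exact (Matrix.isUnit_iff_isUnit_det _).2 (isUnit_of_mul_isUnit_right this)

theorem dotProduct_pow_mulVec_eq_sum {n : Type*} [Fintype n] [DecidableEq n] {A : Matrix n n ℝ}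
    (hA : A.IsHermitian) (v : n → ℝ) (k : ℕ) : v ⬝ᵥ (A ^ k *ᵥ v) =
      ∑ i, ((star (hA.eigenvectorUnitary : Matrix n n ℝ)) *ᵥ v) i ^ 2 * hA.eigenvalues i ^ k := by
  set U := (hA.eigenvectorUnitary : Matrix n n ℝ) with hU
  have hpow : A ^ k = U * (diagonal fun i => hA.eigenvalues i ^ k) * star U := by
    conv_lhs => rw [hA.spectral_theorem]
    rw [← map_pow, Unitary.conjStarAlgAut_apply, Matrix.diagonal_pow]
    rfl
  rw [hpow, ← Matrix.mulVec_mulVec, ← Matrix.mulVec_mulVec, Matrix.dotProduct_mulVec]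
  have : v ᵥ* U = star U *ᵥ v := by
    rw [Matrix.star_eq_conjTranspose, Matrix.conjTranspose_eq_transpose_of_trivial,
      Matrix.mulVec_transpose]
  rw [this, dotProduct]
  refine Finset.sum_congr rfl fun i _ => ?_
  rw [Matrix.mulVec_diagonal]
  ring

/-- Gaussian quadrature: a finite sequence with positive definite Hankel matrix and positive
semidefinite shifted Hankel matrix is represented by a finitely supported measure. -/
theorem exists_quadrature {N : ℕ} {m : ℕ → ℝ}
    (h0 : (Matrix.of fun i j : Fin N => m (i + j)).PosDef)
    (h1 : (Matrix.of fun i j : Fin N => m (i + j + 1)).PosSemidef) :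
    ∃ w θ : Fin N → NNReal, ∀ k < N, m k = ∑ i, (w i : ℝ) * (θ i : ℝ) ^ k := by
  rcases Nat.eq_zero_or_pos N with rfl | hN
  · exact ⟨0, 0, fun k hk => absurd hk (Nat.not_lt_zero k)⟩
  set H : Matrix (Fin N) (Fin N) ℝ := Matrix.of fun i j => m (i + j) with hH
  set H' : Matrix (Fin N) (Fin N) ℝ := Matrix.of fun i j => m (i + j + 1) with hH'
  obtain ⟨B, hB, hHB⟩ := exists_isUnit_eq_conjTranspose_mul_self h0
  have hBdet : IsUnit B.det := (Matrix.isUnit_iff_isUnit_det _).1 hB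
  have hBHdet : IsUnit (Bᴴ).det := by rw [Matrix.det_conjTranspose]; exact hBdet.star
  -- `A` is multiplication by x in orthonormal coordinates, compressed to degree below N, and B e_k
  -- represents x^k. Its eigenvalues are the nodes, nonnegative since the shifted form is, and the
  -- weights are the squared coordinates of 1 = B e₀ in an eigenbasis.
  set A : Matrix (Fin N) (Fin N) ℝ := (B⁻¹)ᴴ * H' * B⁻¹ with hA
  have hApos : A.PosSemidef := h1.conjTranspose_mul_mul_same B⁻¹
  let e : Fin N → Fin N → ℝ := fun k => Pi.single k 1
  let v : Fin N → ℝ := B *ᵥ e ⟨0, hN⟩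
  have hshift : ∀ k (hk : k + 1 < N), H' *ᵥ e ⟨k, by omega⟩ = H *ᵥ e ⟨k + 1, hk⟩ := by
    intro k hk
    ext i
    simp [e, hH, hH', add_assoc]
  have hpow : ∀ k (hk : k < N), A ^ k *ᵥ v = B *ᵥ e ⟨k, hk⟩ := by
    intro k
    induction k with
    | zero => intro hk; simp [v]
    | succ k ih =>
      intro hk
      rw [pow_succ', ← Matrix.mulVec_mulVec, ih (by omega), Matrix.mulVec_mulVec, hA,
        Matrix.mul_assoc, Matrix.nonsing_inv_mul _ hBdet, Matrix.mul_one, ← Matrix.mulVec_mulVec,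
        hshift k hk, hHB, Matrix.mulVec_mulVec, ← Matrix.mul_assoc, ← Matrix.conjTranspose_mul,
        Matrix.mul_nonsing_inv _ hBdet, Matrix.conjTranspose_one, Matrix.one_mul]
  refine ⟨fun i => ⟨((star (hApos.1.eigenvectorUnitary : Matrix (Fin N) (Fin N) ℝ)) *ᵥ v) i ^ 2,
    sq_nonneg _⟩, fun i => ⟨hApos.1.eigenvalues i, hApos.eigenvalues_nonneg i⟩, fun k hk => ?_⟩
  have hmk : m k = v ⬝ᵥ (A ^ k *ᵥ v) := by
    have h2 : m k = e ⟨0, hN⟩ ⬝ᵥ (H *ᵥ e ⟨k, hk⟩) := by simp [e, hH]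
    rw [h2, hpow k hk, hHB, ← Matrix.mulVec_mulVec, Matrix.dotProduct_mulVec]
    congr 1
    rw [Matrix.conjTranspose_eq_transpose_of_trivial, Matrix.vecMul_transpose]
  rw [hmk, dotProduct_pow_mulVec_eq_sum hApos.1]
  rfl

/-- Every Stieltjes-positive sequence is a limit of moments of finitely supported measures. -/
theorem exists_approx_quadrature {m : ℕ → ℝ} (h0 : HankelPosSemidef m)
    (h1 : HankelPosSemidef fun n => m (n + 1)) (N : ℕ) :
    ∃ w θ : Fin N → NNReal, ∀ k < N,
      |∑ i, (w i : ℝ) * (θ i : ℝ) ^ k - m k| ≤ 1 / ((N : ℝ) + 1) := by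
  -- A small multiple of the moments of N distinct atoms in (0, 1] is added: the Vandermonde matrix
  -- makes the Hankel form definite, and positivity of the atoms keeps the shifted form
  -- semidefinite.
  let t : Fin N → ℝ := fun j => 1 / ((j : ℝ) + 1)
  have ht0 : ∀ j, 0 ≤ t j := fun j => by positivity
  have ht1 : ∀ j, t j ≤ 1 := fun j => by
    simp only [t]
    rw [div_le_one (by positivity)]
    linarith [(Nat.cast_nonneg (j : ℕ) : (0 : ℝ) ≤ (j : ℕ))]
  have htinj : Function.Injective t := by
    intro i j hij
    have : (i : ℝ) + 1 = (j : ℝ) + 1 := by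
      simpa [t] using hij
    exact Fin.ext (by exact_mod_cast add_right_cancel this)
  -- Each moment of the N atoms is at most N, so the error is below ε (N+1) = 1/(N+1).
  let ε : ℝ := 1 / ((N : ℝ) + 1) ^ 2
  have hε : 0 < ε := by positivity
  let V : Matrix (Fin N) (Fin N) ℝ := Matrix.vandermonde t
  have hV : (Vᴴ * V).PosDef := by
    refine Matrix.PosDef.conjTranspose_mul_self V ?_
    refine Matrix.mulVec_injective_iff_isUnit.2 ((Matrix.isUnit_iff_isUnit_det _).2 ?_)
    exact isUnit_iff_ne_zero.2 (Matrix.det_vandermonde_ne_zero_iff.2 htinj)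
  have hV' : (Vᴴ * diagonal t * V).PosSemidef :=
    (Matrix.PosSemidef.diagonal ht0).conjTranspose_mul_mul_same V
  have hd0 : (Matrix.of fun i j : Fin N => m (i + j) + ε * ∑ l, t l ^ ((i : ℕ) + j)).PosDef := by
    have := Matrix.PosDef.posSemidef_add (h0 N) (hV.smul hε)
    convert this using 1
    ext i j
    simp [Matrix.mul_apply, V, Matrix.vandermonde_apply, pow_add]
  have hd1 : (Matrix.of fun i j : Fin N =>
      m (i + j + 1) + ε * ∑ l, t l ^ ((i : ℕ) + j + 1)).PosSemidef := by
    have := Matrix.PosSemidef.add (h1 N) (hV'.smul hε.le)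
    convert this using 1
    ext i j
    have hent : (Vᴴ * diagonal t * V) i j = ∑ l, t l ^ ((i : ℕ) + j + 1) := by
      rw [Matrix.mul_apply]
      refine Finset.sum_congr rfl fun l _ => ?_
      simp only [Matrix.mul_diagonal, Matrix.conjTranspose_apply, star_trivial, V,
        Matrix.vandermonde_apply]
      ring
    simp only [Matrix.add_apply, Matrix.smul_apply, Matrix.of_apply, hent, smul_eq_mul]
  obtain ⟨w, θ, h⟩ := exists_quadrature (m := fun n => m n + ε * ∑ l, t l ^ n) hd0 hd1
  refine ⟨w, θ, fun k hk => ?_⟩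
  rw [← h k hk, add_sub_cancel_left]
  have hs0 : 0 ≤ ∑ l, t l ^ k := Finset.sum_nonneg fun l _ => pow_nonneg (ht0 l) k
  have hs1 : ∑ l, t l ^ k ≤ N := by
    calc ∑ l, t l ^ k ≤ ∑ _l : Fin N, (1 : ℝ) :=
          Finset.sum_le_sum fun l _ => pow_le_one₀ (ht0 l) (ht1 l)
      _ = N := by simp
  rw [abs_of_nonneg (by positivity)]
  calc ε * ∑ l, t l ^ k ≤ ε * ((N : ℝ) + 1) := by
        exact mul_le_mul_of_nonneg_left (by linarith) hε.le
    _ = 1 / ((N : ℝ) + 1) := by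
        simp only [ε]
        field_simp

end Moments

/-! ### Construction of the representing measure and integration of Hankel forms -/

section StieltjesMeasure

open Finset MeasureTheory Filter Topology CompactlySupported
open scoped NNReal

/-- The continuous cutoff function equal to `1` on `[0, r]` and to `0` on `[r + 1, ∞)`. -/
noncomputable def cutoff (r : ℕ) (x : ℝ≥0) : ℝ := max 0 (min 1 ((r : ℝ) + 1 - x))

theorem cutoff_nonneg (r : ℕ) (x : ℝ≥0) : 0 ≤ cutoff r x := le_max_left _ _

theorem cutoff_le_one (r : ℕ) (x : ℝ≥0) : cutoff r x ≤ 1 :=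
  max_le zero_le_one (min_le_left _ _)

theorem cutoff_eq_one {r : ℕ} {x : ℝ≥0} (h : x ≤ r) : cutoff r x = 1 := by
  have h' : (x : ℝ) ≤ r := by exact_mod_cast h
  rw [cutoff, min_eq_left (by linarith), max_eq_right zero_le_one]

theorem cutoff_eq_zero {r : ℕ} {x : ℝ≥0} (h : (r : ℝ≥0) + 1 ≤ x) : cutoff r x = 0 := by
  have h' : (r : ℝ) + 1 ≤ x := by exact_mod_cast h
  exact max_eq_left (min_le_iff.2 (Or.inr (by linarith)))

/-- The compactly supported continuous function `x ^ k` cut off at `r`. -/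
noncomputable def cutoffPow (r k : ℕ) : C_c(ℝ≥0, ℝ) where
  toFun x := (x : ℝ) ^ k * cutoff r x
  continuous_toFun := by
    unfold cutoff
    fun_prop
  hasCompactSupport' := by
    refine HasCompactSupport.intro (K := Set.Icc 0 ((r : ℝ≥0) + 1)) isCompact_Icc fun x hx => ?_
    have hx' : (r : ℝ≥0) + 1 ≤ x := by
      by_contra h
      exact hx ⟨zero_le, (not_le.1 h).le⟩
    rw [cutoff_eq_zero hx', mul_zero]

theorem cutoffPow_apply (r k : ℕ) (x : ℝ≥0) : cutoffPow r k x = (x : ℝ) ^ k * cutoff r x := rfl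

theorem cutoffPow_le (r k : ℕ) (x : ℝ≥0) : cutoffPow r k x ≤ (x : ℝ) ^ k :=
  mul_le_of_le_one_right (by positivity) (cutoff_le_one r x)

/-- Beyond r one has x^k ≤ x^(k+1)/r, so the next moment controls what the cutoff loses. This
prevents mass from escaping to infinity. -/
theorem le_cutoffPow {r : ℕ} (hr : 0 < r) (k : ℕ) (x : ℝ≥0) :
    (x : ℝ) ^ k - (x : ℝ) ^ (k + 1) / r ≤ cutoffPow r k x := by
  have hr' : (0 : ℝ) < r := by exact_mod_cast hr
  rcases le_total x r with h | h
  · rw [cutoffPow_apply, cutoff_eq_one h, mul_one, sub_le_self_iff]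
    positivity
  · have h' : (r : ℝ) ≤ x := by exact_mod_cast h
    have h1 : (x : ℝ) ^ k ≤ (x : ℝ) ^ (k + 1) / r := by
      rw [le_div_iff₀ hr', pow_succ]
      exact mul_le_mul_of_nonneg_left h' (by positivity)
    have h2 : 0 ≤ cutoffPow r k x := mul_nonneg (by positivity) (cutoff_nonneg r x)
    linarith

/-- A positive functional on `C_c([0, ∞))` obtained as a limit of finitely supported measures
whose moments converge to `m`. -/
theorem exists_positive_functional {m : ℕ → ℝ} (w θ : (N : ℕ) → Fin N → ℝ≥0)
    (h : ∀ k, Tendsto (fun N => ∑ i, (w N i : ℝ) * (θ N i : ℝ) ^ k) atTop (𝓝 (m k))) :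
    ∃ Λ : C_c(ℝ≥0, ℝ) →ₚ[ℝ] ℝ, ∀ g : C_c(ℝ≥0, ℝ), ∀ (c : ℕ → ℝ) (d : ℕ),
      ((∀ x : ℝ≥0, g x ≤ ∑ k ∈ range d, c k * (x : ℝ) ^ k) → Λ g ≤ ∑ k ∈ range d, c k * m k) ∧
      ((∀ x : ℝ≥0, ∑ k ∈ range d, c k * (x : ℝ) ^ k ≤ g x) → ∑ k ∈ range d, c k * m k ≤ Λ g) := by
  -- Along an ultrafilter every bounded sequence converges, which replaces the extraction of a
  -- weakly convergent subsequence. Boundedness comes from the convergent zeroth moments.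
  let U : Ultrafilter ℕ := Filter.hyperfilter ℕ
  have hU : (U : Filter ℕ) ≤ atTop := by
    rw [← Nat.cofinite_eq_atTop]
    exact Filter.hyperfilter_le_cofinite
  let I : ℕ → C_c(ℝ≥0, ℝ) → ℝ := fun N g => ∑ i, (w N i : ℝ) * g (θ N i)
  have hpoly : ∀ (c : ℕ → ℝ) (d : ℕ), Tendsto
      (fun N => ∑ i, (w N i : ℝ) * ∑ k ∈ range d, c k * (θ N i : ℝ) ^ k) U
      (𝓝 (∑ k ∈ range d, c k * m k)) := by
    intro c d
    have : (fun N => ∑ i, (w N i : ℝ) * ∑ k ∈ range d, c k * (θ N i : ℝ) ^ k) =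
        fun N => ∑ k ∈ range d, c k * ∑ i, (w N i : ℝ) * (θ N i : ℝ) ^ k := by
      ext N
      simp_rw [Finset.mul_sum]
      rw [Finset.sum_comm]
      exact Finset.sum_congr rfl fun k _ => Finset.sum_congr rfl fun i _ => by ring
    rw [this]
    exact tendsto_finsetSum _ fun k _ => ((h k).mono_left hU).const_mul _
  have hlim : ∀ g, ∃ L, Tendsto (fun N => I N g) U (𝓝 L) := by
    intro g
    obtain ⟨B, hB⟩ := g.hasCompactSupport.exists_bound_of_continuous g.continuous
    have hbd : ∀ N, |I N g| ≤ B * ∑ i, (w N i : ℝ) * (θ N i : ℝ) ^ 0 := by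
      intro N
      calc |I N g| ≤ ∑ i, |(w N i : ℝ) * g (θ N i)| := Finset.abs_sum_le_sum_abs _ _
        _ ≤ ∑ i, B * ((w N i : ℝ) * (θ N i : ℝ) ^ 0) := Finset.sum_le_sum fun i _ => by
            rw [abs_mul, pow_zero, mul_one, abs_of_nonneg (NNReal.coe_nonneg _), mul_comm]
            exact mul_le_mul_of_nonneg_right (hB _) (NNReal.coe_nonneg _)
        _ = _ := by rw [Finset.mul_sum]
    obtain ⟨D, hD⟩ := ((h 0).const_mul B).bddAbove_range
    have hmem : ∀ N, I N g ∈ Set.Icc (-D) D := fun N =>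
      abs_le.1 ((hbd N).trans (hD ⟨N, rfl⟩))
    obtain ⟨L, -, hL⟩ := isCompact_Icc.ultrafilter_le_nhds (U.map fun N => I N g)
      (Filter.le_principal_iff.2 (Filter.Eventually.of_forall (f := (U : Filter ℕ)) hmem))
    exact ⟨L, hL⟩
  choose Λ hΛ using hlim
  let L : C_c(ℝ≥0, ℝ) →ₗ[ℝ] ℝ :=
    { toFun := Λ
      map_add' := fun g g' => tendsto_nhds_unique (hΛ (g + g')) (by
        convert (hΛ g).add (hΛ g') using 2 with N
        simp [I, mul_add, Finset.sum_add_distrib])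
      map_smul' := fun c g => tendsto_nhds_unique (hΛ (c • g)) (by
        refine ((hΛ g).const_mul c).congr fun N => ?_
        simp only [I, Finset.mul_sum]
        exact Finset.sum_congr rfl fun i _ => by
          rw [CompactlySupportedContinuousMap.smul_apply, smul_eq_mul]
          ring) }
  refine ⟨PositiveLinearMap.mk₀ L fun g hg => ge_of_tendsto' (hΛ g) fun N =>
    Finset.sum_nonneg fun i _ => mul_nonneg (NNReal.coe_nonneg _) (hg _), fun g c d => ⟨fun hg => ?_,
      fun hg => ?_⟩⟩
  · exact le_of_tendsto_of_tendsto' (hΛ g) (hpoly c d) fun N => Finset.sum_le_sum fun i _ =>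
      mul_le_mul_of_nonneg_left (hg _) (NNReal.coe_nonneg _)
  · exact le_of_tendsto_of_tendsto' (hpoly c d) (hΛ g) fun N => Finset.sum_le_sum fun i _ =>
      mul_le_mul_of_nonneg_left (hg _) (NNReal.coe_nonneg _)

/-- Stieltjes' theorem: existence in the moment problem on `[0, ∞)`. -/
theorem isStieltjesMoment_of_hankelPosSemidef {m : ℕ → ℝ} (h0 : HankelPosSemidef m)
    (h1 : HankelPosSemidef fun n => m (n + 1)) : IsStieltjesMoment m := by
  choose w θ h using exists_approx_quadrature h0 h1
  have hlim : ∀ k, Tendsto (fun N => ∑ i, (w N i : ℝ) * (θ N i : ℝ) ^ k) atTop (𝓝 (m k)) := by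
    intro k
    rw [tendsto_iff_norm_sub_tendsto_zero]
    refine squeeze_zero' (Eventually.of_forall fun N => norm_nonneg _) ?_
      tendsto_one_div_add_atTop_nhds_zero_nat
    filter_upwards [eventually_gt_atTop k] with N hN
    exact h N k hN
  obtain ⟨Λ, hΛ⟩ := exists_positive_functional w θ hlim
  set μ := RealRMK.rieszMeasure Λ with hμ
  have hint : ∀ g : C_c(ℝ≥0, ℝ), ∫ x, g x ∂μ = Λ g := RealRMK.integral_rieszMeasure Λ
  have hupper : ∀ r k, Λ (cutoffPow r k) ≤ m k := fun r k => by
    have := (hΛ (cutoffPow r k) (fun j => if j = k then 1 else 0) (k + 1)).1 fun x => by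
      simpa using cutoffPow_le r k x
    simpa using this
  have hlower : ∀ r k, 0 < r → m k - m (k + 1) / r ≤ Λ (cutoffPow r k) := fun r k hr => by
    have hsum : ∀ y : ℕ → ℝ, ∑ j ∈ range (k + 2),
        (if j = k then (1 : ℝ) else if j = k + 1 then -1 / r else 0) * y j =
        y k - y (k + 1) / r := fun y => by
      rw [Finset.sum_range_succ, Finset.sum_range_succ, Finset.sum_eq_zero fun j hj => by
        rw [Finset.mem_range] at hj
        rw [if_neg (by omega), if_neg (by omega), zero_mul]]
      simp
      ring
    have := (hΛ (cutoffPow r k) (fun j => if j = k then 1 else if j = k + 1 then -1 / r else 0)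
      (k + 2)).2 fun x => by
        rw [hsum]
        exact le_cutoffPow hr k x
    rwa [hsum] at this
  have hcover : AECover μ atTop fun r : ℕ => Set.Iic (r : ℝ≥0) :=
    aecover_Iic tendsto_natCast_atTop_atTop
  have hIcc : ∀ r : ℝ≥0, Set.Iic r = Set.Icc 0 r := fun r => by
    ext x
    simp
  have hcont : ∀ k : ℕ, Continuous fun x : ℝ≥0 => (x : ℝ) ^ k := fun k => by fun_prop
  have hon : ∀ (k r : ℕ), IntegrableOn (fun x : ℝ≥0 => (x : ℝ) ^ k) (Set.Iic (r : ℝ≥0)) μ :=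
    fun k r => by
      rw [hIcc]
      exact (hcont k).continuousOn.integrableOn_compact isCompact_Icc
  have hge : ∀ k r : ℕ, Λ (cutoffPow r k) ≤ ∫ x in Set.Iic ((r + 1 : ℕ) : ℝ≥0), (x : ℝ) ^ k ∂μ := by
    intro k r
    rw [← hint, ← integral_indicator measurableSet_Iic]
    refine integral_mono (cutoffPow r k).integrable
      ((hon k (r + 1)).integrable_indicator measurableSet_Iic) fun x => ?_
    by_cases hx : x ∈ Set.Iic ((r + 1 : ℕ) : ℝ≥0)
    · rw [Set.indicator_of_mem hx]
      exact cutoffPow_le r k x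
    · rw [Set.indicator_of_notMem hx, cutoffPow_apply, cutoff_eq_zero, mul_zero]
      push_cast at hx
      exact (not_le.1 hx).le
  have hle : ∀ k r : ℕ, ∫ x in Set.Iic (r : ℝ≥0), (x : ℝ) ^ k ∂μ ≤ Λ (cutoffPow r k) := by
    intro k r
    rw [← hint, ← integral_indicator measurableSet_Iic]
    refine integral_mono ((hon k r).integrable_indicator measurableSet_Iic)
      (cutoffPow r k).integrable fun x => ?_
    by_cases hx : x ∈ Set.Iic (r : ℝ≥0)
    · rw [Set.indicator_of_mem hx, cutoffPow_apply, cutoff_eq_one hx, mul_one]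
    · rw [Set.indicator_of_notMem hx]
      exact mul_nonneg (by positivity) (cutoff_nonneg r x)
  -- The integral over [0, r+1] lies between m_k - m_{k+1}/r and m_k; monotone exhaustion then gives
  -- both integrability and the moments.
  have htend : ∀ k, Tendsto (fun r : ℕ => ∫ x in Set.Iic (r : ℝ≥0), (x : ℝ) ^ k ∂μ) atTop
      (𝓝 (m k)) := by
    intro k
    rw [← tendsto_add_atTop_iff_nat 1]
    have hl : Tendsto (fun r : ℕ => m k - m (k + 1) / r) atTop (𝓝 (m k)) := by
      simpa using (tendsto_const_div_atTop_nhds_zero_nat (m (k + 1))).const_sub (m k)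
    refine tendsto_of_tendsto_of_tendsto_of_le_of_le' hl tendsto_const_nhds ?_
      (Eventually.of_forall fun r => (hle k (r + 1)).trans (hupper _ _))
    filter_upwards [eventually_gt_atTop 0] with r hr
    exact (hlower r k hr).trans (hge k r)
  have hnn : ∀ k : ℕ, ∀ x : ℝ≥0, 0 ≤ (x : ℝ) ^ k := fun k x => by positivity
  have hInt : ∀ k : ℕ, Integrable (fun x : ℝ≥0 => (x : ℝ) ^ k) μ := fun k =>
    hcover.integrable_of_integral_tendsto_of_nonneg_ae (m k) (hon k)
      (Eventually.of_forall (hnn k)) (htend k)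
  have hEq : ∀ k : ℕ, ∫ x : ℝ≥0, (x : ℝ) ^ k ∂μ = m k := fun k =>
    hcover.integral_eq_of_tendsto_of_nonneg_ae (m k) (Eventually.of_forall (hnn k)) (hon k) (htend k)
  have hmeas : Measurable ((↑) : ℝ≥0 → ℝ) := measurable_coe_nnreal_real
  refine ⟨μ.map (↑), ?_, fun k => ⟨?_, ?_⟩⟩
  · rw [Measure.map_apply hmeas measurableSet_Iio]
    have : ((↑) : ℝ≥0 → ℝ) ⁻¹' Set.Iio 0 = ∅ := by
      ext x
      simp
    rw [this, measure_empty]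
  · rw [integrable_map_measure (by fun_prop) hmeas.aemeasurable]
    exact hInt k
  · rw [integral_map hmeas.aemeasurable (by fun_prop)]
    exact (hEq k).symm

theorem isStieltjesMoment_of_isTP_hankel {a : ℕ → ℝ} (h : IsTP (hankelMatrix a)) :
    IsStieltjesMoment a :=
  isStieltjesMoment_of_hankelPosSemidef (hankelPosSemidef_of_isTP h)
    (hankelPosSemidef_of_isTP (isTP_hankel_succ h))

theorem hankelPosSemidef_integral {μ : Measure ℝ} {a : ℕ → ℝ → ℝ}
    (hint : ∀ n, Integrable (a n) μ) (h : ∀ᵐ u ∂μ, HankelPosSemidef fun n => a n u) :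
    HankelPosSemidef fun n => ∫ u, a n u ∂μ := by
  intro N
  refine Matrix.PosSemidef.of_dotProduct_mulVec_nonneg
    (isHermitian_hankel (fun n => ∫ u, a n u ∂μ) N) fun x => ?_
  have key : star x ⬝ᵥ (Matrix.of fun i j : Fin N => ∫ u, a (i + j) u ∂μ).mulVec x =
      ∫ u, star x ⬝ᵥ (Matrix.of fun i j : Fin N => a (i + j) u).mulVec x ∂μ := by
    simp only [dotProduct, Matrix.mulVec, Matrix.of_apply]
    rw [integral_finsetSum _ fun i _ => Integrable.const_mul
      (integrable_finsetSum _ fun j _ => (hint _).mul_const _) _]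
    refine Finset.sum_congr rfl fun i _ => ?_
    rw [integral_const_mul, integral_finsetSum _ fun j _ => (hint _).mul_const _]
    congr 1
    exact Finset.sum_congr rfl fun j _ => (integral_mul_const _ _).symm
  rw [key]
  refine integral_nonneg_of_ae ?_
  filter_upwards [h] with u hu
  exact (hu N).dotProduct_mulVec_nonneg x

/-- The convolution is a double integral of the forms ∑ A_{n,k} u^k v^{n-k}, and semidefiniteness
survives integration, first in u and then in v. The shift `s` serves both Hankel matrices in
Stieltjes' criterion. -/
theorem triConvolution_hankelPosSemidef {A : Matrix ℕ ℕ ℝ} {x y : ℕ → ℝ} {s : ℕ}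
    (hx : IsStieltjesMoment x) (hy : IsStieltjesMoment y)
    (hA : ∀ u v : ℝ, 0 ≤ u → 0 ≤ v → HankelPosSemidef fun n =>
      ∑ k ∈ range (n + s + 1), A (n + s) k * (u ^ k * v ^ (n + s - k))) :
    HankelPosSemidef fun n => triConvolution A x y (n + s) := by
  obtain ⟨μ, hμ0, hμ⟩ := hx
  obtain ⟨ν, hν0, hν⟩ := hy
  have hae : ∀ {ρ : Measure ℝ}, ρ (Set.Iio 0) = 0 → ∀ᵐ u ∂ρ, 0 ≤ u := fun {ρ} hρ => by
    rw [ae_iff]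
    convert hρ using 2
    ext u
    simp
  have step : ∀ v, 0 ≤ v → HankelPosSemidef fun n =>
      ∑ k ∈ range (n + s + 1), A (n + s) k * (x k * v ^ (n + s - k)) := by
    intro v hv
    have := hankelPosSemidef_integral (μ := μ)
      (a := fun n u => ∑ k ∈ range (n + s + 1), A (n + s) k * (u ^ k * v ^ (n + s - k)))
      (fun n => integrable_finsetSum _ fun k _ => ((hμ k).1.mul_const _).const_mul _)
      ((hae hμ0).mono fun u hu => hA u v hu hv)
    convert this using 2 with n
    rw [integral_finsetSum _ fun k _ => ((hμ k).1.mul_const _).const_mul _]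
    refine Finset.sum_congr rfl fun k _ => ?_
    rw [integral_const_mul, integral_mul_const, (hμ k).2]
  have := hankelPosSemidef_integral (μ := ν)
    (a := fun n v => ∑ k ∈ range (n + s + 1), A (n + s) k * (x k * v ^ (n + s - k)))
    (fun n => integrable_finsetSum _ fun k _ => ((hν _).1.const_mul _).const_mul _)
    ((hae hν0).mono fun v hv => step v hv)
  convert this using 2 with n
  rw [integral_finsetSum _ fun k _ => ((hν _).1.const_mul _).const_mul _, triConvolution]
  refine Finset.sum_congr rfl fun k _ => ?_
  rw [integral_const_mul, integral_const_mul, (hν _).2, mul_assoc]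

end StieltjesMeasure

/-! ### Minors of the inverse matrix -/

section Jacobi

open Finset Matrix

variable {R : Type*} [CommRing R]

/-- Laplace expansion along columns which are standard basis vectors. -/
theorem det_of_standard_columns {m : ℕ} : ∀ {n : ℕ} (A : Matrix (Fin n) (Fin n) R)
    (I J : Fin m ↪o Fin n), (∀ i l, A i (I l) = if i = J l then 1 else 0) →
    ∃ (d : ℕ) (r c : Fin d ↪o Fin n), (∀ p l, c p ≠ I l) ∧
      A.det = (-1) ^ (∑ l, (I l : ℕ) + ∑ l, (J l : ℕ)) * (A.submatrix r c).det := by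
  induction m with
  | zero =>
    intro n A I J _
    exact ⟨n, RelEmbedding.refl _, RelEmbedding.refl _, fun _ l => l.elim0, by simp⟩
  | succ m ih =>
    intro n A I J hA
    obtain _ | n := n
    · exact (I 0).elim0
    set i₀ := I (Fin.last m) with hi₀
    set j₀ := J (Fin.last m) with hj₀
    have hI : ∀ l : Fin m, I l.castSucc < i₀ := fun l => I.strictMono (Fin.castSucc_lt_last l)
    have hJ : ∀ l : Fin m, J l.castSucc < j₀ := fun l => J.strictMono (Fin.castSucc_lt_last l)
    let I' : Fin m ↪o Fin n := OrderEmbedding.ofStrictMono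
      (fun l => ⟨I l.castSucc, lt_of_lt_of_le (hI l) (Nat.lt_succ_iff.1 i₀.2)⟩)
      fun a b hab => I.strictMono (Fin.castSucc_lt_castSucc_iff.2 hab)
    let J' : Fin m ↪o Fin n := OrderEmbedding.ofStrictMono
      (fun l => ⟨J l.castSucc, lt_of_lt_of_le (hJ l) (Nat.lt_succ_iff.1 j₀.2)⟩)
      fun a b hab => J.strictMono (Fin.castSucc_lt_castSucc_iff.2 hab)
    have hI' : ∀ l, i₀.succAbove (I' l) = I l.castSucc := fun l =>
      Fin.succAbove_of_castSucc_lt _ _ (hI l)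
    have hJ' : ∀ l, j₀.succAbove (J' l) = J l.castSucc := fun l =>
      Fin.succAbove_of_castSucc_lt _ _ (hJ l)
    obtain ⟨d, r, c, hc, hdet⟩ := ih (A.submatrix j₀.succAbove i₀.succAbove) I' J' fun i l => by
      rw [Matrix.submatrix_apply, hI', hA, ← hJ']
      simp only [Fin.succAbove_right_inj]
    refine ⟨d, r.trans (Fin.succAboveOrderEmb j₀), c.trans (Fin.succAboveOrderEmb i₀),
      fun p l => ?_, ?_⟩
    · refine Fin.lastCases ?_ (fun l => ?_) l
      · exact Fin.succAbove_ne i₀ (c p)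
      · rw [← hI']
        exact fun h => hc p l (Fin.succAbove_right_injective h)
    -- Removing the last distinguished column first leaves the positions of the earlier ones
    -- unchanged, so the signs accumulate with the original indices.
    · rw [Matrix.det_succ_column A i₀, Finset.sum_eq_single j₀]
      · rw [hA, if_pos rfl, hdet, Fin.sum_univ_castSucc, Fin.sum_univ_castSucc,
          Matrix.submatrix_submatrix]
        have h1 : ∑ l, (I' l : ℕ) = ∑ l : Fin m, (I l.castSucc : ℕ) := rfl
        have h2 : ∑ l, (J' l : ℕ) = ∑ l : Fin m, (J l.castSucc : ℕ) := rfl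
        have h3 : A.submatrix (r.trans (Fin.succAboveOrderEmb j₀))
            (c.trans (Fin.succAboveOrderEmb i₀)) =
            A.submatrix (j₀.succAbove ∘ r) (i₀.succAbove ∘ c) := rfl
        rw [h1, h2, h3, ← hi₀, ← hj₀, mul_one, ← mul_assoc, ← pow_add]
        congr 2
        ring
      · intro i _ hi
        rw [hA, if_neg hi]
        ring
      · simp

/-- Jacobi's formula for the minors of the inverse matrix. -/
theorem det_mul_minor_of_mul_eq_one {n m : ℕ} {M N : Matrix (Fin n) (Fin n) R} (h : M * N = 1)
    (I J : Fin m ↪o Fin n) : ∃ (d : ℕ) (r c : Fin d ↪o Fin n),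
      M.det * (N.submatrix I J).det =
        (-1) ^ (∑ l, (I l : ℕ) + ∑ l, (J l : ℕ)) * (M.submatrix r c).det := by
  classical
  -- The identity with columns `I` replaced by columns `J` of `N`. Its determinant is the minor of
  -- `N`, while `M * Y` has standard vectors in columns `I` and the columns of `M` elsewhere.
  let Y : Matrix (Fin n) (Fin n) R := Matrix.of fun i j =>
    Function.extend I (fun l => N i (J l)) (fun k => (1 : Matrix (Fin n) (Fin n) R) i k) j
  have hYI : ∀ i l, Y i (I l) = N i (J l) := fun i l => by
    simp only [Y, Matrix.of_apply]
    exact I.injective.extend_apply _ _ _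
  have hYn : ∀ i j, (¬ ∃ l, I l = j) → Y i j = (1 : Matrix (Fin n) (Fin n) R) i j :=
    fun i j hj => by
      simp only [Y, Matrix.of_apply]
      exact Function.extend_apply' _ _ _ hj
  have hYdet : Y.det = (N.submatrix I J).det := by
    rw [Matrix.twoBlockTriangular_det' Y (fun i => ∃ l, I l = i) fun i hi j hj => by
      rw [hYn i j hj, Matrix.one_apply_ne]
      rintro rfl
      exact hj hi]
    have h2 : (Y.toSquareBlockProp fun i => ¬ ∃ l, I l = i) = 1 := by
      ext i j
      rw [Matrix.toSquareBlockProp_def, Matrix.of_apply, hYn _ _ j.2, Matrix.one_apply,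
        Matrix.one_apply]
      simp only [Subtype.ext_iff]
    have h1 : (Y.toSquareBlockProp fun i => ∃ l, I l = i).det = (N.submatrix I J).det := by
      let e : Fin m ≃ {i // ∃ l, I l = i} := Equiv.ofInjective I I.injective
      rw [← Matrix.det_submatrix_equiv_self e]
      congr 1
      ext i j
      exact hYI _ _
    rw [h1, h2, Matrix.det_one, mul_one]
  have hMYI : ∀ i l, (M * Y) i (I l) = if i = J l then 1 else 0 := fun i l => by
    rw [Matrix.mul_apply, Finset.sum_congr rfl fun k _ => by rw [hYI], ← Matrix.mul_apply, h,
      Matrix.one_apply]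
  obtain ⟨d, r, c, hc, hdet⟩ := det_of_standard_columns (M * Y) I J hMYI
  refine ⟨d, r, c, ?_⟩
  rw [← hYdet, ← Matrix.det_mul, hdet]
  congr 2
  ext i j
  rw [Matrix.submatrix_apply, Matrix.submatrix_apply, Matrix.mul_apply,
    Finset.sum_congr rfl fun k _ => by rw [hYn k (c j) fun ⟨l, hl⟩ => hc j l hl.symm],
    ← Matrix.mul_apply, Matrix.mul_one]

/-- The signed inverse of a totally positive lower triangular matrix is totally positive. -/
theorem isTP_signed_inverse {M N : Matrix ℕ ℕ ℝ} (hM : IsTP M)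
    (h : ∀ n i k, i < n → k < n → ∑ j ∈ range n, M i j * N j k = if i = k then 1 else 0) :
    IsTP (Matrix.of fun n k => (-1 : ℝ) ^ (n + k) * N n k) := by
  intro m r c
  obtain ⟨n, hn⟩ := (Finset.univ.image r ∪ Finset.univ.image c).exists_nat_subset_range
  have hr : ∀ i, r i < n := fun i => by
    simpa using hn (Finset.mem_union_left _ (Finset.mem_image_of_mem r (Finset.mem_univ i)))
  have hc : ∀ i, c i < n := fun i => by
    simpa using hn (Finset.mem_union_right _ (Finset.mem_image_of_mem c (Finset.mem_univ i)))
  let I : Fin m ↪o Fin n := OrderEmbedding.ofStrictMono (fun i => ⟨r i, hr i⟩)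
    fun _ _ hij => r.strictMono hij
  let J : Fin m ↪o Fin n := OrderEmbedding.ofStrictMono (fun i => ⟨c i, hc i⟩)
    fun _ _ hij => c.strictMono hij
  let M' : Matrix (Fin n) (Fin n) ℝ := M.submatrix Fin.val Fin.val
  let N' : Matrix (Fin n) (Fin n) ℝ := N.submatrix Fin.val Fin.val
  have hMN : M' * N' = 1 := by
    ext i k
    rw [Matrix.mul_apply, Matrix.one_apply]
    have := h n i k i.2 k.2
    rw [Finset.sum_range] at this
    simp only [Fin.ext_iff]
    exact this
  obtain ⟨d, r', c', hdet⟩ := det_mul_minor_of_mul_eq_one hMN I J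
  -- Total positivity gives ≥ 0 and invertibility excludes 0. The signs (-1)^(n+k) cancel those of
  -- Jacobi's formula.
  have hMdet : 0 < M'.det := by
    refine lt_of_le_of_ne (hM n (Fin.valOrderEmb n) (Fin.valOrderEmb n)) fun h0 => ?_
    have := congrArg Matrix.det hMN
    rw [Matrix.det_mul, ← h0] at this
    simp at this
  have hminor : matMinor (Matrix.of fun n k => (-1 : ℝ) ^ (n + k) * N n k) r c =
      (-1) ^ (∑ l, r l + ∑ l, c l) * (N'.submatrix I J).det := by
    have h1 : (Matrix.of fun n k => (-1 : ℝ) ^ (n + k) * N n k).submatrix r c =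
        Matrix.of fun i j => (-1 : ℝ) ^ (r i) *
          (Matrix.of fun i j => (-1 : ℝ) ^ (c j) * N'.submatrix I J i j) i j := by
      ext i j
      simp only [Matrix.submatrix_apply, Matrix.of_apply, pow_add, mul_assoc]
      rfl
    rw [matMinor, h1, Matrix.det_mul_column, Matrix.det_mul_row, pow_add,
      Finset.prod_pow_eq_pow_sum, Finset.prod_pow_eq_pow_sum, mul_assoc]
  have hfin : M'.det * matMinor (Matrix.of fun n k => (-1 : ℝ) ^ (n + k) * N n k) r c =
      (M'.submatrix r' c').det := by
    have h2 : ((-1 : ℝ) ^ (∑ l, r l + ∑ l, c l)) * (-1) ^ (∑ l, r l + ∑ l, c l) = 1 := by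
      rw [← mul_pow]
      simp
    have h3 : M'.det * (N'.submatrix I J).det =
        (-1) ^ (∑ l, r l + ∑ l, c l) * (M'.submatrix r' c').det := hdet
    rw [hminor]
    linear_combination (-1 : ℝ) ^ (∑ l, r l + ∑ l, c l) * h3 + (M'.submatrix r' c').det * h2
  refine nonneg_of_mul_nonneg_right ?_ hMdet
  rw [hfin]
  exact hM d (r'.trans (Fin.valOrderEmb n)) (c'.trans (Fin.valOrderEmb n))

end Jacobi

/-! ### The inverse Sheffer triangle and the sequence (f_{n+1}) -/

section ShefferInverse

open Finset PowerSeries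

variable {f : PowerSeries ℝ}

/-- With h the inverse of f and K = 1/G(h), the sum is (i!/k!) [t^i] G·(K h^k)(f), and substituting
f reduces G·K(f)·h(f)^k to t^k. -/
theorem sum_shefferTriangle_mul_inverse (hf0 : constantCoeff f = 0) (hf1 : coeff 1 f ≠ 0)
    {G : PowerSeries ℝ} (hG : constantCoeff G ≠ 0) (n i k : ℕ) (hi : i < n) :
    ∑ j ∈ range n, shefferTriangle f G i j * shefferTriangle (f.substInvOfIsUnit hf1.isUnit)
      (composeSeries G (f.substInvOfIsUnit hf1.isUnit))⁻¹ j k = if i = k then 1 else 0 := by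
  set h := f.substInvOfIsUnit hf1.isUnit with hh
  have hh0 : constantCoeff h = 0 := constantCoeff_substInvOfIsUnit f hf1.isUnit
  have hsf : HasSubst f := HasSubst.of_constantCoeff_zero' hf0
  have hsh : HasSubst h := HasSubst.of_constantCoeff_zero' hh0
  set K := (composeSeries G h)⁻¹ with hK
  have hGh0 : constantCoeff (composeSeries G h) ≠ 0 := by
    have := coeff_mul_subst hh0 1 G 0
    rw [one_mul, Finset.sum_range_one, pow_zero, one_mul, coeff_zero_one, mul_one,
      coeff_zero_eq_constantCoeff_apply, coeff_zero_eq_constantCoeff_apply] at this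
    rw [composeSeries, this]
    exact hG
  have hleft : h.subst f = (X : PowerSeries ℝ) := subst_substInvOfIsUnit_left f hf0 hf1.isUnit
  have hKG : G * K.subst f = 1 := by
    have h1 := congrArg (PowerSeries.subst f) (PowerSeries.mul_inv_cancel _ hGh0)
    have hone : (1 : PowerSeries ℝ).subst f = (1 : PowerSeries ℝ) := by
      rw [← coe_substAlgHom hsf, map_one]
    rw [subst_mul hsf, hone, composeSeries, subst_comp_subst_apply hsh hsf, hleft, X_subst] at h1
    exact h1
  have hterm : ∀ j ∈ range n, shefferTriangle f G i j * shefferTriangle h K j k =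
      (i.factorial : ℝ) / k.factorial * (coeff j (K * h ^ k) * coeff i (G * f ^ j)) := by
    intro j _
    have := Nat.factorial_ne_zero j
    rw [shefferTriangle_eq hf0, shefferTriangle_eq hh0]
    simp only [Algebra.algebraMap_self, RingHom.id_apply]
    field_simp
  rw [Finset.sum_congr rfl hterm, ← Finset.mul_sum,
    sum_range_eq_of_le (a := i + 1) (by omega) fun l hl => by
      rw [coeff_mul_pow_eq_zero hf0 G (by omega), mul_zero],
    ← coeff_mul_subst hf0, subst_mul hsf, subst_pow hsf, hleft, ← mul_assoc, hKG, one_mul,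
    coeff_X_pow]
  split_ifs with hik
  · rw [hik, mul_one, div_self (by positivity)]
  · rw [mul_zero]

theorem constantCoeff_shefferG {R : Type*} [CommRing R] [Algebra ℚ R] [BinomialRing R]
    {F : PowerSeries R} (hF : constantCoeff F = 0) (γ l : R) :
    constantCoeff (shefferG γ l F) = 1 := by
  rw [shefferG, map_mul, constantCoeff_onePlusPow hF, constantCoeff_expSeries hF, mul_one]

/-- The Hankel matrix of the derivative sequence `(f_{n+1})`. -/
theorem isTP_hankel_derivative {φ : PowerSeries ℝ} (hf0 : constantCoeff f = 0)
    (hf1 : coeff 1 f ≠ 0) (hf : derivative ℝ f = (1 + f) * φ.subst f) (hφ : IsPF φ) :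
    IsTP (hankelMatrix fun n => ((n + 1).factorial : ℝ) * coeff (n + 1) f) := by
  have hS : ∀ x : ℝ, 0 ≤ x → algebraMap ℝ ℝ x ∈ Subsemiring.nonneg ℝ := fun x hx => hx
  have hG : shefferG 0 0 f = 1 := by
    rw [shefferG, expSeries_zero hf0, onePlusPow, binomialSeries_zero,
      ← coe_substAlgHom (HasSubst.of_constantCoeff_zero' hf0), map_one, mul_one]
  have hT := isOutputMatrix_shefferTriangle hf0 hf (0 : ℝ) 0
  have hP : MinorsIn (Subsemiring.nonneg ℝ) (shefferProduction (fun n => coeff n φ) (1 : ℝ) 0 0) :=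
    minorsIn_shefferProduction hS hφ (Subsemiring.one_mem _) (Subsemiring.zero_mem _)
      (Subsemiring.zero_mem _)
  have hPz := shefferProduction_eq_zero (fun n => coeff n φ) (1 : ℝ) 0 0
  set P := shefferProduction (fun n => coeff n φ) (1 : ℝ) 0 0
  simp only [Algebra.algebraMap_self, PowerSeries.map_id, hG, id_eq] at hT
  have hentry : ∀ n k, shefferTriangle f 1 n k =
      (n.factorial : ℝ) / k.factorial * coeff n (f ^ k) := fun n k => by
    rw [shefferTriangle_eq hf0, one_mul]
    rfl
  set T := shefferTriangle f 1
  have hfone : 0 < coeff 1 f := by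
    refine lt_of_le_of_ne ?_ hf1.symm
    have : (0 : ℝ) ≤ T 1 1 := (hT.minorsIn hP).entry 1 1
    simpa [hentry] using this
  let succEmb : ℕ ↪o ℕ :=
    OrderEmbedding.ofStrictMono (· + 1) fun _ _ h => Nat.add_lt_add_right h 1
  -- For g = 1, column 0 of `T` vanishes below the top, so deleting the first row and column of `P`
  -- governs the shifted triangle. Dividing by f_1 normalizes its corner; column 0 is then
  -- f_{n+1}/f_1.
  have hT' : IsOutputMatrix (Matrix.of fun n k => (coeff 1 f)⁻¹ * T (n + 1) (k + 1))
      (P.submatrix succEmb succEmb) := by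
    refine ⟨fun k => ?_, fun n k => ?_⟩
    · rcases k with _ | k
      · simp [hentry, hf1]
      · rw [Matrix.of_apply, hT.upper_eq_zero hPz _ _ (by omega), mul_zero, if_neg (by omega)]
    · filter_upwards [Filter.eventually_ge_atTop (n + 1)] with N hN
      have h0 : T (n + 1) 0 = 0 := by
        rw [hentry, pow_zero, coeff_one, if_neg (by omega), mul_zero]
      rw [sum_range_eq_of_le hN fun l hl => by
        rw [Matrix.of_apply, hT.upper_eq_zero hPz _ _ (by omega), mul_zero, zero_mul],
        Matrix.of_apply, hT.succ_eq_sum hPz, Finset.sum_range_succ', h0, zero_mul, add_zero,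
        Finset.mul_sum]
      exact Finset.sum_congr rfl fun j _ => (mul_assoc _ _ _).symm
  have hH := hT'.minorsIn_hankel (fun k l hkl => hPz _ _ (Nat.add_lt_add_right hkl 1))
    (hP.submatrix succEmb succEmb)
  have := hH.const_mul (s := coeff 1 f) hfone.le
  have e : (hankelMatrix fun n => ((n + 1).factorial : ℝ) * coeff (n + 1) f) =
      Matrix.of fun i j => coeff 1 f * hankelMatrix
        (fun n => Matrix.of (fun n k => (coeff 1 f)⁻¹ * T (n + 1) (k + 1)) n 0) i j := by
    ext i j
    simp only [hankelMatrix, Matrix.of_apply, hentry]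
    simp
    field_simp
  rw [e]
  exact this

end ShefferInverse

/-! ### The main theorem -/

theorem mainTheorem7 (f : PowerSeries ℝ) (hf0 : PowerSeries.constantCoeff f = 0)
    (hf1 : PowerSeries.coeff 1 f ≠ 0)
    (hPF : IsPF (((1 + PowerSeries.X) *
      PowerSeries.derivative ℝ (f.substInvOfIsUnit hf1.isUnit))⁻¹)) :
    -- indeterminates `γ, l, q`; `g = (1 + f) ^ γ * exp (l f)`
    (let γ : MvPolynomial (Fin 3) ℝ := MvPolynomial.X 0
     let l : MvPolynomial (Fin 3) ℝ := MvPolynomial.X 1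
     let q : MvPolynomial (Fin 3) ℝ := MvPolynomial.X 2
     let F := liftSeries (Fin 3) f
     IsCoeffSM (shefferSeq F (shefferG γ l F) q) ∧
     IsKCoeffLogConvex 3 (shefferSeq F (shefferG γ l F) q) ∧
     IsCoeffSM (shefferRecipSeq F (shefferG γ l F) q) ∧
     IsKCoeffLogConvex 3 (shefferRecipSeq F (shefferG γ l F) q)) ∧
    -- indeterminates `γ, q`
    (let γ : MvPolynomial (Fin 2) ℝ := MvPolynomial.X 0
     let q : MvPolynomial (Fin 2) ℝ := MvPolynomial.X 1
     let F := liftSeries (Fin 2) f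
     IsCoeffSM (shefferSeq F (onePlusPow γ F) q) ∧
     IsKCoeffLogConvex 3 (shefferSeq F (onePlusPow γ F) q)) ∧
    -- `f = ∑ f_n t ^ n / n!`
    (IsStieltjesMoment (fun n => ((n + 1).factorial : ℝ) * PowerSeries.coeff (n + 1) f) ∧
     IsKLogConvex 3 (fun n => ((n + 1).factorial : ℝ) * PowerSeries.coeff (n + 1) f)) ∧
    -- indeterminates `γ, l`
    (let γ : MvPolynomial (Fin 2) ℝ := MvPolynomial.X 0
     let l : MvPolynomial (Fin 2) ℝ := MvPolynomial.X 1
     let F := liftSeries (Fin 2) f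
     IsCoeffTP (shefferTriangle F (shefferG γ l F))) ∧
    -- nonnegative real `γ, l`
    (∀ γ l : ℝ, 0 ≤ γ → 0 ≤ l →
      IsTP (Matrix.of fun n k => (-1 : ℝ) ^ (n + k) *
        shefferTriangle (f.substInvOfIsUnit hf1.isUnit)
          (composeSeries (shefferG γ l f) (f.substInvOfIsUnit hf1.isUnit))⁻¹ n k)) ∧
    (∀ γ l : ℝ, 0 ≤ γ → 0 ≤ l → ∀ x y : ℕ → ℝ, IsStieltjesMoment x → IsStieltjesMoment y →
      IsStieltjesMoment (triConvolution (shefferTriangle f (shefferG γ l f)) x y)) := by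
  have hf := derivative_eq_one_add_mul_subst hf0 hf1
  have hS : ∀ (σ : Type) (x : ℝ), 0 ≤ x →
      algebraMap ℝ (MvPolynomial σ ℝ) x ∈ coeffNonnegSubsemiring σ :=
    fun _ _ hx => C_mem_coeffNonnegSubsemiring hx
  have hSR : ∀ x : ℝ, 0 ≤ x → algebraMap ℝ ℝ x ∈ Subsemiring.nonneg ℝ := fun _ hx => hx
  have hmap : f.map (algebraMap ℝ ℝ) = f := by
    simp only [Algebra.algebraMap_self, PowerSeries.map_id, id_eq]
  have hX3 := X_mem_coeffNonnegSubsemiring (σ := Fin 3)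
  have hX2 := X_mem_coeffNonnegSubsemiring (σ := Fin 2)
  refine ⟨?_, ?_, ?_, ?_, fun γ l hγ hl => ?_, fun γ l hγ hl x y hx hy => ?_⟩
  · have h1 := minorsIn_hankel_shefferSeq (hS (Fin 3)) hf0 hf hPF (hX3 0) (hX3 1) (hX3 2)
    have h2 := minorsIn_hankel_shefferRecipSeq (hS (Fin 3)) hf0 hf hPF (hX3 0) (hX3 1) (hX3 2)
    exact ⟨h1, fun m hm i => h1.iterate_logConvexOp_mem hm i, h2,
      fun m hm i => h2.iterate_logConvexOp_mem hm i⟩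
  · have h1 := minorsIn_hankel_shefferSeq (hS (Fin 2)) hf0 hf hPF (hX2 0)
      (Subsemiring.zero_mem _) (hX2 1)
    rw [shefferG_zero_right hf0] at h1
    exact ⟨h1, fun m hm i => h1.iterate_logConvexOp_mem hm i⟩
  · have h1 := isTP_hankel_derivative hf0 hf1 hf hPF
    exact ⟨isStieltjesMoment_of_isTP_hankel h1, fun m hm i =>
      MinorsIn.iterate_logConvexOp_mem (S := Subsemiring.nonneg ℝ) h1 hm i⟩
  · exact minorsIn_shefferTriangle (hS (Fin 2)) hf0 hf hPF (hX2 0) (hX2 1)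
  · have hTP := minorsIn_shefferTriangle hSR hf0 hf hPF hγ hl
    rw [hmap] at hTP
    refine isTP_signed_inverse hTP fun n i k hi _ =>
      sum_shefferTriangle_mul_inverse hf0 hf1 ?_ n i k hi
    rw [constantCoeff_shefferG hf0]
    exact one_ne_zero
  · have hH : ∀ u v : ℝ, 0 ≤ u → 0 ≤ v →
        IsTP (hankelMatrix (shefferForm f (shefferG γ l f) u v)) := fun u v hu hv => by
      have := minorsIn_hankel_shefferForm hSR hf0 hf hPF hγ hl hu hv
      rwa [hmap] at this
    exact isStieltjesMoment_of_hankelPosSemidef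
      (triConvolution_hankelPosSemidef (s := 0) hx hy fun u v hu hv =>
        hankelPosSemidef_of_isTP (hH u v hu hv))
      (triConvolution_hankelPosSemidef (s := 1) hx hy fun u v hu hv =>
        hankelPosSemidef_of_isTP (isTP_hankel_succ (hH u v hu hv)))
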